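/- Let $s:\mathbb C\to\mathbb C$ be one of the following three functions: $s=\sigma$, the Weierstrass sigma function $\sigma(z)=z\prod_{l\in\Lambda\setminus\{0\}}(1-z/l)e^{z/l+z^2/(2l^2)}$ of a period lattice $\Lambda$; $s=\sinh$; or $s(x)=x$. Let $\alpha,\beta,\gamma\in\mathbb C$ with $\alpha+\beta+\gamma=0$, and put $$f(q,p;\alpha)=\frac{s(q+p+\alpha)\,s(q-p+\alpha)}{s(q+p-\alpha)\,s(q-p-\alpha)}.$$ For a field $q:\mathbb Z^2\to\mathbb C$ write $q=q(n_1,n_2)$, $q_{i,j}=q(n_1+i,n_2+j)$, and let $T_1,T_2$ be the unit shifts in $n_1$ and $n_2$. Consider the 7-point equation $$f(q,q_{1,0};\alpha)f(q,q_{-1,0};\alpha)f(q,q_{0,1};\beta)f(q,q_{0,-1};\beta)f(q,q_{-1,-1};\gamma)f(q,q_{1,1};\gamma)=1\qquad(Q)$$ and the flows $$\frac{q_{,x}+1}{q_{,x}-1}=f(q,q_{1,0};\alpha)f(q,q_{0,-1};\beta)f(q,q_{1,1};\gamma)=f(q,q_{-1,0};-\alpha)f(q,q_{0,1};-\beta)f(q,q_{-1,-1};-\gamma),$$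 $$\frac{q_{,y}+1}{q_{,y}-1}=f(q,q_{-1,0};\alpha)f(q,q_{0,1};\beta)f(q,q_{1,1};\gamma)=f(q,q_{1,0};-\alpha)f(q,q_{0,-1};-\beta)f(q,q_{-1,-1};-\gamma),$$ $$\frac{q_{,z}+1}{q_{,z}-1}=f(q,q_{-1,0};\alpha)f(q,q_{0,-1};\beta)f(q,q_{-1,-1};\gamma)=f(q,q_{1,0};-\alpha)f(q,q_{0,1};-\beta)f(q,q_{1,1};-\gamma).$$ All statements concern points at which the $s$-factors occurring in the equation do not vanish and the right-hand sides of the flows under consideration are not $1$. A pointwise statement at a site requires (Q) and these conditions only at that site and its six neighbours. Then the following hold. 1. (Q) is consistent with each of the three flows: on solutions of (Q) the two forms of the flow coincide, and the derivative of the left-hand side of (Q) along the flow vanishes at every site. 2. The flows commute on solutions of (Q): $\partial_x\partial_yq=\partial_y\partial_xq$, and likewise for the other pairs. 3. Let $$S=\sum_{n\in\mathbb Z^2}\bigl(\varphi(q,q_{-1,0};\alpha)+\varphi(q,q_{0,-1};\beta)+\varphi(q,q_{1,1};\gamma)\bigr),\qquad \partial_q\varphi(q,p;\alpha)=\log f(q,p;\alpha),\quad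 \varphi(q,p;\alpha)=\varphi(p,q;\alpha).$$ This (multivalued) functional is defined near every lattice solution $q^0$ of (Q): on each edge there is an analytic branch of $\varphi$ near $q^0$ whose derivatives in the first and second argument are branches of $\log f(q,p)$ and $\log f(p,q)$, and the branches can be chosen so that $q^0$ satisfies the Euler–Lagrange equation $\delta S/\delta q=0$. Each of the three flows is a variational symmetry of $S$: it has a translation-invariant extension $q_{,\tau}=K$ off the solutions of (Q), where $K$ depends on $q$ and its six neighbours only, is analytic at every solution point and coincides there with the flow, such that near every lattice solution $q^0$ and for every such choice of branches the derivative of the density $L$ of $S$ along this extension is a total difference, $\partial_\tau L=(T_1-1)A+(T_2-1)B$, identically in $q$ near $q^0$, where $A$ and $B$ are analytic functions of finitely many values of $q$ around the site (and may depend on the site, because the branches may). -/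

import Mathlib

open Filter Topology

noncomputable section

namespace TriLattice

/-- The Weierstrass sigma function of a period lattice, by its canonical product
`σ(z) = z ∏ (1 - z/l) exp (z/l + z²/(2l²))` over the nonzero lattice points `l`. -/
def weierstrassSigma (L : PeriodPair) (z : ℂ) : ℂ :=
  z * ∏' l : {l : L.lattice // l ≠ 0},
    ((1 - z / (l : ℂ)) * Complex.exp (z / (l : ℂ) + (z / (l : ℂ)) ^ 2 / 2))

/-- The three admissible choices `s = σ`, `s = sinh`, `s(x) = x`. -/
def IsAdmissible (s : ℂ → ℂ) : Prop :=
  (∃ L : PeriodPair, s = weierstrassSigma L) ∨ s = Complex.sinh ∨ s = fun x => x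

/-- A complex field on the triangular lattice, `q (n₁, n₂)`; the value at `n + (i, j)` is what is
written `q_{i,j}`. -/
abbrev Field := ℤ × ℤ → ℂ

/-- `f(q, p; α) = s(q+p+α) s(q-p+α) / (s(q+p-α) s(q-p-α))`. -/
def factor (s : ℂ → ℂ) (q p α : ℂ) : ℂ :=
  (s (q + p + α) * s (q - p + α)) / (s (q + p - α) * s (q - p - α))

/-- The three directions of the triangular lattice; they carry the parameters
`a 0 = α`, `a 1 = β`, `a 2 = γ`. -/
def dir : Fin 3 → ℤ × ℤ := ![(1, 0), (0, 1), (-1, -1)]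

/-- A site (the origin) together with its six neighbours. -/
def star : Finset (ℤ × ℤ) :=
  {(0, 0), (1, 0), (-1, 0), (0, 1), (0, -1), (-1, -1), (1, 1)}

/-- All `s`-factors that occur in numerators and denominators at the site `n` are nonzero. -/
def IsRegularAt (s : ℂ → ℂ) (a : Fin 3 → ℂ) (q : Field) (n : ℤ × ℤ) : Prop :=
  ∀ k : Fin 3, ∀ e : ℤ × ℤ, (e = dir k ∨ e = -dir k) →
    s (q n + q (n + e) + a k) ≠ 0 ∧ s (q n - q (n + e) + a k) ≠ 0 ∧
    s (q n + q (n + e) - a k) ≠ 0 ∧ s (q n - q (n + e) - a k) ≠ 0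

/-- The left-hand side of the multiplicative 7-point equation at the site `n`. -/
def eqProd (s : ℂ → ℂ) (a : Fin 3 → ℂ) (q : Field) (n : ℤ × ℤ) : ℂ :=
  factor s (q n) (q (n + (1, 0))) (a 0) * factor s (q n) (q (n + (-1, 0))) (a 0) *
  factor s (q n) (q (n + (0, 1))) (a 1) * factor s (q n) (q (n + (0, -1))) (a 1) *
  factor s (q n) (q (n + (-1, -1))) (a 2) * factor s (q n) (q (n + (1, 1))) (a 2)

/-- The 7-point equation holds at the site `n`. -/
def IsSolutionAt (s : ℂ → ℂ) (a : Fin 3 → ℂ) (q : Field) (n : ℤ × ℤ) : Prop :=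
  IsRegularAt s a q n ∧ eqProd s a q n = 1

/-- The first form of the right-hand sides of the flows `∂_x` (`j = 0`), `∂_y` (`j = 1`),
`∂_z` (`j = 2`). -/
def flowProd (s : ℂ → ℂ) (a : Fin 3 → ℂ) (j : Fin 3) (q : Field) (n : ℤ × ℤ) : ℂ :=
  match j with
  | 0 => factor s (q n) (q (n + (1, 0))) (a 0) * factor s (q n) (q (n + (0, -1))) (a 1) *
      factor s (q n) (q (n + (1, 1))) (a 2)
  | 1 => factor s (q n) (q (n + (-1, 0))) (a 0) * factor s (q n) (q (n + (0, 1))) (a 1) *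
      factor s (q n) (q (n + (1, 1))) (a 2)
  | 2 => factor s (q n) (q (n + (-1, 0))) (a 0) * factor s (q n) (q (n + (0, -1))) (a 1) *
      factor s (q n) (q (n + (-1, -1))) (a 2)

/-- The second form of the right-hand sides of the flows. -/
def flowProd' (s : ℂ → ℂ) (a : Fin 3 → ℂ) (j : Fin 3) (q : Field) (n : ℤ × ℤ) : ℂ :=
  match j with
  | 0 => factor s (q n) (q (n + (-1, 0))) (-a 0) * factor s (q n) (q (n + (0, 1))) (-a 1) *
      factor s (q n) (q (n + (-1, -1))) (-a 2)
  | 1 => factor s (q n) (q (n + (1, 0))) (-a 0) * factor s (q n) (q (n + (0, -1))) (-a 1) *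
      factor s (q n) (q (n + (-1, -1))) (-a 2)
  | 2 => factor s (q n) (q (n + (1, 0))) (-a 0) * factor s (q n) (q (n + (0, 1))) (-a 1) *
      factor s (q n) (q (n + (1, 1))) (-a 2)

/-- The vector field of the `j`-th flow: the solution `v` of `(v + 1) / (v - 1) = flowProd`. -/
def velocity (s : ℂ → ℂ) (a : Fin 3 → ℂ) (j : Fin 3) (q : Field) : Field :=
  fun n => (flowProd s a j q n + 1) / (flowProd s a j q n - 1)

/-- The 7-point equation holds at `n` and the `j`-th flow is finite there. -/
def IsFlowPoint (s : ℂ → ℂ) (a : Fin 3 → ℂ) (j : Fin 3) (q : Field) (n : ℤ × ℤ) : Prop :=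
  IsSolutionAt s a q n ∧ flowProd s a j q n ≠ 1

/-- Consistency of the 7-point equation with the `j`-th flow: on solutions the two forms of the
flow agree, and the derivative of the equation at any site along the flow vanishes. The equation
is only required on the sites that enter, namely a site and its neighbours. -/
def IsConsistent (s : ℂ → ℂ) (a : Fin 3 → ℂ) (j : Fin 3) : Prop :=
  (∀ (q : Field) (n : ℤ × ℤ), IsFlowPoint s a j q n →
    velocity s a j q n ≠ 1 ∧
    (velocity s a j q n + 1) / (velocity s a j q n - 1) = flowProd s a j q n ∧
    (velocity s a j q n + 1) / (velocity s a j q n - 1) = flowProd' s a j q n) ∧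
  ∀ (q : Field) (n : ℤ × ℤ), (∀ m ∈ star, IsFlowPoint s a j q (n + m)) →
    HasDerivAt (fun t : ℂ => eqProd s a (q + t • velocity s a j q) n) 0 0

/-- The flows `i` and `j` commute on solutions: `∂_i (∂_j q) = ∂_j (∂_i q)` at every site. -/
def FlowsCommute (s : ℂ → ℂ) (a : Fin 3 → ℂ) (i j : Fin 3) : Prop :=
  ∀ (q : Field) (n : ℤ × ℤ),
    (∀ m ∈ star, IsFlowPoint s a i q (n + m) ∧ IsFlowPoint s a j q (n + m)) →
    ∃ c : ℂ,
      HasDerivAt (fun t : ℂ => velocity s a j (q + t • velocity s a i q) n) c 0 ∧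
      HasDerivAt (fun t : ℂ => velocity s a i (q + t • velocity s a j q) n) c 0

/-- The restriction of a field to the translate by `n` of a finite set of sites. -/
def window (S : Finset (ℤ × ℤ)) (n : ℤ × ℤ) (q : Field) : S → ℂ := fun i => q (n + i)

/-- The summand at the site `n` of the functional
`S = ∑_n φ(q, q_{-1,0}; α) + φ(q, q_{0,-1}; β) + φ(q, q_{1,1}; γ)`; here `φ n k` is the local
branch of `φ` on the edge from `n` to `n - dir k`. -/
def lagrangian (φ : ℤ × ℤ → Fin 3 → ℂ × ℂ → ℂ) (n : ℤ × ℤ) (q : Field) : ℂ :=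
  ∑ k : Fin 3, φ n k (q n, q (n - dir k))

/-- The variational derivative of `S` with respect to `q n`: the sum of the derivatives with
respect to `q n` of the six edge terms that contain it. -/
def variationalDerivative (φ : ℤ × ℤ → Fin 3 → ℂ × ℂ → ℂ) (q : Field) (n : ℤ × ℤ) : ℂ :=
  ∑ k : Fin 3, (deriv (fun t : ℂ => φ n k (t, q (n - dir k))) (q n) +
    deriv (fun t : ℂ => φ (n + dir k) k (q (n + dir k), t)) (q n))

/-- `φ` is a choice of branches, near the field `q₀`, of the multivalued functional `S`:
`∂φ(q,p)/∂q` is a branch of `log f(q,p)`, by the symmetry `φ(q,p) = φ(p,q)` the derivative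
`∂φ(q,p)/∂p` is a branch of `log f(p,q)`, and the branches are such that the Euler-Lagrange
equation of `S` holds at `q₀`. -/
def IsActionBranch (s : ℂ → ℂ) (a : Fin 3 → ℂ) (q₀ : Field)
    (φ : ℤ × ℤ → Fin 3 → ℂ × ℂ → ℂ) : Prop :=
  (∀ n k, AnalyticAt ℂ (φ n k) (q₀ n, q₀ (n - dir k)) ∧
    ∀ᶠ z in 𝓝 (q₀ n, q₀ (n - dir k)),
      Complex.exp (deriv (fun t : ℂ => φ n k (t, z.2)) z.1) = factor s z.1 z.2 (a k) ∧
      Complex.exp (deriv (fun t : ℂ => φ n k (z.1, t)) z.2) = factor s z.2 z.1 (a k)) ∧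
  ∀ n, variationalDerivative φ q₀ n = 0

/-- The `j`-th flow is a variational symmetry of `S`. The flow is given on solutions only, so, as
usual, this means that it has an analytic translation-invariant extension `v` off the solutions
(with characteristic `K`, a function of the seven values at a site and its neighbours) for which
the derivative of the density of `S` along `v` is a total difference
`(T₁ - 1) A + (T₂ - 1) B` of local functions, identically near every solution.
(`A`, `B` may carry the site as an index because the branches of `S` may.) -/
def IsVariationalSymmetry (s : ℂ → ℂ) (a : Fin 3 → ℂ) (j : Fin 3) : Prop :=
  ∃ K : (star → ℂ) → ℂ,
    (∀ (q : Field) (n : ℤ × ℤ), IsFlowPoint s a j q n →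
      AnalyticAt ℂ K (window star n q) ∧ K (window star n q) = velocity s a j q n) ∧
    ∀ (q₀ : Field) (φ : ℤ × ℤ → Fin 3 → ℂ × ℂ → ℂ),
      (∀ n, IsFlowPoint s a j q₀ n) → IsActionBranch s a q₀ φ →
      ∃ (S : Finset (ℤ × ℤ)) (A B : ℤ × ℤ → (S → ℂ) → ℂ),
        (∀ n, AnalyticAt ℂ (A n) (window S n q₀) ∧ AnalyticAt ℂ (B n) (window S n q₀)) ∧
        ∀ n, ∀ᶠ q in 𝓝 q₀,
          HasDerivAt
            (fun t : ℂ => lagrangian φ n (q + t • fun m => K (window star m q)))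
            (A (n + (1, 0)) (window S (n + (1, 0)) q) - A n (window S n q) +
              (B (n + (0, 1)) (window S (n + (0, 1)) q) - B n (window S n q))) 0

end TriLattice

end

/-! All three functions $s$ are odd and entire, and $s(x+p)s(x-p)$ (`bracket`) is an alternating
form of rank two, so it obeys the Plücker relation. Apart from $s'(0)\ne0$, which excludes $s=0$,
nothing else about $s$ is used.

Write a product of three factors with common first argument $q$ and parameters of sum zero as $N/D$.
The heart of the proof is the three-leg identity `legDiff_symm`: $(N-D)/s(2q)$ is the same function
seen from either end of a leg, hence belongs to a rhombus of the lattice. The velocity is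
$v=(N+D)/(N-D)$, so $2\,d\log(N-D)=v\,d\log(N/D)+d\log(ND)$. Logarithmic derivatives of the
three-leg identity are therefore linear relations between velocities at nearby sites
(`legVelocity_leg`, `legVelocity_diagonal`). On solutions of (Q) the two forms of a flow allow each
velocity to be read off from either of two rhombi. Four such relations add up to the linearisation
of (Q), which is consistency. Two of them express the derivative of one flow along another by data
at one site, and commutativity then reduces to the logarithmic derivative of a Plücker relation
(`bracket_cross_deriv`).

For the action, let $Q$ be the left-hand side of (Q) and $P$ the first form of the flow. Near a
solution $\delta S/\delta q=\log Q$. The flow is extended by $K=1-2\log\frac{P-Q}{P-1}/\log Q$,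
whose singularity at $Q=1$ is removable with value $(P+1)/(P-1)$. Then $K\log Q$ is the logarithm of
$Q\,((P-1)/(P-Q))^2$, and by the three-leg identity this is a product of ratios of rhombus and edge
functions at neighbouring sites (`eqProd_div_sq`). So $K\,\delta S/\delta q$ is a divergence, and
summation by parts turns this into the statement on the density.

For $\sigma$, the rank-two property is the three-term identity. It follows from
$(\log\sigma)''=-\wp$, which gives quasi-periodicity, and from Liouville's theorem. -/

noncomputable section

namespace TriLattice

/-! ### The rank-two form and the three-leg identity. -/

section

/-- An entire odd function, with nonzero derivative at the origin, for which `s (x + p) * s (x - p)`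
is an alternating form of rank two; this is what is used of the sigma function and of its
hyperbolic and rational degenerations. -/
structure IsSigmaLike (s : ℂ → ℂ) : Prop where
  differentiable : Differentiable ℂ s
  odd : ∀ x, s (-x) = -s x
  rank_two : ∃ g h : ℂ → ℂ, ∀ x p, s (x + p) * s (x - p) = g x * h p - h x * g p
  deriv_zero : deriv s 0 ≠ 0

/-- The alternating form `s (x + p) * s (x - p)`. -/
def bracket (s : ℂ → ℂ) (x p : ℂ) : ℂ := s (x + p) * s (x - p)

theorem factor_eq_bracket (s : ℂ → ℂ) (q p α : ℂ) :
    factor s q p α = bracket s (q + α) p / bracket s (q - α) p := by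
  simp only [factor, bracket]
  congr 3 <;> ring_nf

/-- The product of the numerators of three factors with a common first argument; for the opposite
parameters this is the product of the denominators. -/
def legProd (s : ℂ → ℂ) (α β γ q x y z : ℂ) : ℂ :=
  bracket s (q + α) x * bracket s (q + β) y * bracket s (q + γ) z

/-- The difference of numerator and denominator of a product of three factors. -/
def legDiff (s : ℂ → ℂ) (α β γ q x y z : ℂ) : ℂ :=
  legProd s α β γ q x y z - legProd s (-α) (-β) (-γ) q x y z

theorem legProd_swap (s : ℂ → ℂ) (α β γ q x y z : ℂ) :
    legProd s α γ β q x z y = legProd s α β γ q x y z := by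
  simp only [legProd]; ring

theorem legDiff_swap (s : ℂ → ℂ) (α β γ q x y z : ℂ) :
    legDiff s α γ β q x z y = legDiff s α β γ q x y z := by
  simp only [legDiff, legProd_swap]

namespace IsSigmaLike

variable {s : ℂ → ℂ}

theorem analyticAt (hs : IsSigmaLike s) (z : ℂ) : AnalyticAt ℂ s z :=
  hs.differentiable.analyticAt z

theorem continuous (hs : IsSigmaLike s) : Continuous s := hs.differentiable.continuous

theorem bracket_swap (hs : IsSigmaLike s) (x p : ℂ) : bracket s p x = -bracket s x p := by
  have := hs.odd (x - p)
  simp only [bracket]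
  rw [show p - x = -(x - p) by ring, this, add_comm]
  ring

/-- The Plücker relation of an alternating form $g\wedge h$ of rank two: any four vectors of a plane
satisfy it. -/
theorem pluecker (hs : IsSigmaLike s) (u v w y : ℂ) :
    bracket s u v * bracket s w y - bracket s w v * bracket s u y =
      bracket s u w * bracket s v y := by
  obtain ⟨g, h, H⟩ := hs.rank_two
  simp only [bracket, H]
  ring

/-- Since $s'(0)\ne0$, $s$ is not identically zero and its zeros are isolated. This permits dividing
by $s(2a)$ after a small shift and then passing to the limit. -/
theorem eventually_ne_zero (hs : IsSigmaLike s) (a : ℂ) :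
    ∀ᶠ t in 𝓝[≠] (0 : ℂ), s (2 * (a + t)) ≠ 0 := by
  have hd : Differentiable ℂ fun t : ℂ => s (2 * (a + t)) :=
    hs.differentiable.comp (by fun_prop)
  rcases (hd.analyticAt 0).eventually_eq_zero_or_eventually_ne_zero with h | h
  · exfalso
    have h0 : (fun t : ℂ => s (2 * (a + t))) = 0 :=
      AnalyticOnNhd.eq_of_eventuallyEq (fun z _ => hd.analyticAt z)
        (fun z _ => analyticAt_const) h
    have hz : s = fun _ => 0 := by
      funext z
      have := congrFun h0 (z / 2 - a)
      simpa [mul_div_cancel₀] using this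
    apply hs.deriv_zero
    rw [hz]
    simp
  · exact h

theorem eq_of_eventually_punctured {F G : ℂ → ℂ} (hF : Continuous F) (hG : Continuous G)
    (h : ∀ᶠ t in 𝓝[≠] (0 : ℂ), F t = G t) : F 0 = G 0 :=
  tendsto_nhds_unique ((hF.tendsto 0).mono_left nhdsWithin_le_nhds)
    (((hG.tendsto 0).mono_left nhdsWithin_le_nhds).congr' (h.mono fun _ ht => ht.symm))

/-- As the form has rank two, `bracket s u y` is a combination of the brackets of $q\pm\beta$ with
$y$, and likewise for $z$ with $q\pm\gamma$. Expanding the legs at $x$ in this way leaves four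
coefficients to compare. The factor in front clears the denominators of the expansion. -/
theorem legDiff_symm_mul (hs : IsSigmaLike s) (β γ q x y z : ℂ) :
    s (2 * q) ^ 2 * s (2 * β) * s (2 * γ) * (s (2 * x) * legDiff s (-β - γ) β γ q x y z) =
      s (2 * q) ^ 2 * s (2 * β) * s (2 * γ) * (s (2 * q) * legDiff s (-β - γ) γ β x q y z) := by
  have e1 (δ : ℂ) : bracket s (q + δ) (q - δ) = s (2 * q) * s (2 * δ) := by
    simp only [bracket]; ring_nf
  have py (u : ℂ) : bracket s u y * (s (2 * q) * s (2 * β)) =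
      bracket s (q + β) y * bracket s u (q - β) - bracket s (q - β) y * bracket s u (q + β) := by
    rw [← e1]
    linear_combination hs.pluecker u y (q + β) (q - β) +
      bracket s u (q + β) * hs.bracket_swap (q - β) y
  have pz (u : ℂ) : bracket s u z * (s (2 * q) * s (2 * γ)) =
      bracket s (q + γ) z * bracket s u (q - γ) - bracket s (q - γ) z * bracket s u (q + γ) := by
    rw [← e1]
    linear_combination hs.pluecker u z (q + γ) (q - γ) +
      bracket s u (q + γ) * hs.bracket_swap (q - γ) z
  -- The two mixed coefficients cancel: with $\alpha=-\beta-\gamma$ both sides contain the same six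
  -- $s$-factors. The two pure coefficients, `h3` and `h4` below, need one more Plücker relation,
  -- `hp`.
  have h1 : bracket s (x + (-β - γ)) q * bracket s (x + γ) (q - β) * bracket s (x + β) (q + γ) =
      bracket s (x - (-β - γ)) q * bracket s (x - γ) (q - β) * bracket s (x - β) (q + γ) := by
    simp only [bracket]; ring_nf
  have h2 : bracket s (x + (-β - γ)) q * bracket s (x + γ) (q + β) * bracket s (x + β) (q - γ) =
      bracket s (x - (-β - γ)) q * bracket s (x - γ) (q + β) * bracket s (x - β) (q - γ) := by
    simp only [bracket]; ring_nf
  have hp : s (2 * x) * s (2 * q) * s (2 * β) * s (2 * γ) =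
      bracket s (x + q) (-β - γ) * bracket s (x - q) (β - γ) -
        bracket s (x - q) (-β - γ) * bracket s (x + q) (β - γ) := by
    rw [hs.pluecker]
    simp only [bracket]
    rw [show -β - γ + (β - γ) = -(2 * γ) by ring, show -β - γ - (β - γ) = -(2 * β) by ring,
      hs.odd, hs.odd, show x + q + (x - q) = 2 * x by ring, show x + q - (x - q) = 2 * q by ring]
    ring
  have o1 : bracket s (q + (-β - γ)) x = -(s (x + q + (-β - γ)) * s (x - q - (-β - γ))) := by
    simp only [bracket]
    rw [show q + (-β - γ) - x = -(x - q - (-β - γ)) by ring, hs.odd,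
      show q + (-β - γ) + x = x + q + (-β - γ) by ring]
    ring
  have o2 : bracket s (q - (-β - γ)) x = -(s (x + q - (-β - γ)) * s (x - q + (-β - γ))) := by
    simp only [bracket]
    rw [show q - (-β - γ) - x = -(x - q + (-β - γ)) by ring, hs.odd,
      show q - (-β - γ) + x = x + q - (-β - γ) by ring]
    ring
  have h3 : s (2 * x) * bracket s (q + (-β - γ)) x * (s (2 * q) * s (2 * β) * s (2 * γ)) =
      bracket s (x + (-β - γ)) q * bracket s (x + γ) (q - β) * bracket s (x + β) (q - γ) -
      bracket s (x - (-β - γ)) q * bracket s (x - γ) (q - β) * bracket s (x - β) (q - γ) := by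
    rw [o1]
    calc _ = -(s (x + q + (-β - γ)) * s (x - q - (-β - γ))) *
          (s (2 * x) * s (2 * q) * s (2 * β) * s (2 * γ)) := by ring
      _ = _ := by rw [hp]; simp only [bracket]; ring_nf
  have h4 : -(s (2 * x) * bracket s (q - (-β - γ)) x * (s (2 * q) * s (2 * β) * s (2 * γ))) =
      bracket s (x + (-β - γ)) q * bracket s (x + γ) (q + β) * bracket s (x + β) (q + γ) -
      bracket s (x - (-β - γ)) q * bracket s (x - γ) (q + β) * bracket s (x - β) (q + γ) := by
    rw [o2]
    calc _ = (s (x + q - (-β - γ)) * s (x - q + (-β - γ))) *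
          (s (2 * x) * s (2 * q) * s (2 * β) * s (2 * γ)) := by ring
      _ = _ := by rw [hp]; simp only [bracket]; ring_nf
  simp only [legDiff, legProd, ← sub_eq_add_neg]
  have q1 := py (x + γ)
  have q2 := pz (x + β)
  have q3 := py (x - γ)
  have q4 := pz (x - β)
  have r1 : (s (2 * q) ^ 2 * s (2 * β) * s (2 * γ)) *
      (bracket s (x + γ) y * bracket s (x + β) z) =
      (bracket s (q + β) y * bracket s (x + γ) (q - β) -
        bracket s (q - β) y * bracket s (x + γ) (q + β)) *
      (bracket s (q + γ) z * bracket s (x + β) (q - γ) -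
        bracket s (q - γ) z * bracket s (x + β) (q + γ)) := by
    rw [← q1, ← q2]; ring
  have r2 : (s (2 * q) ^ 2 * s (2 * β) * s (2 * γ)) *
      (bracket s (x - γ) y * bracket s (x - β) z) =
      (bracket s (q + β) y * bracket s (x - γ) (q - β) -
        bracket s (q - β) y * bracket s (x - γ) (q + β)) *
      (bracket s (q + γ) z * bracket s (x - β) (q - γ) -
        bracket s (q - γ) z * bracket s (x - β) (q + γ)) := by
    rw [← q3, ← q4]; ring
  linear_combination (-s (2 * q) * bracket s (x + (-β - γ)) q) * r1 +
    (s (2 * q) * bracket s (x - (-β - γ)) q) * r2 +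
    s (2 * q) * bracket s (q + β) y * bracket s (q + γ) z * h3 +
    s (2 * q) * bracket s (q - β) y * bracket s (q - γ) z * h4 +
    s (2 * q) * bracket s (q + β) y * bracket s (q - γ) z * h1 +
    s (2 * q) * bracket s (q - β) y * bracket s (q + γ) z * h2

theorem continuous_legProd (hs : IsSigmaLike s) {X : Type*} [TopologicalSpace X]
    {α β γ q x y z : X → ℂ} (hα : Continuous α) (hβ : Continuous β) (hγ : Continuous γ)
    (hq : Continuous q) (hx : Continuous x) (hy : Continuous y) (hz : Continuous z) :
    Continuous fun t => legProd s (α t) (β t) (γ t) (q t) (x t) (y t) (z t) := by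
  have := hs.continuous
  unfold legProd bracket
  fun_prop

theorem continuous_legDiff (hs : IsSigmaLike s) {X : Type*} [TopologicalSpace X]
    {α β γ q x y z : X → ℂ} (hα : Continuous α) (hβ : Continuous β) (hγ : Continuous γ)
    (hq : Continuous q) (hx : Continuous x) (hy : Continuous y) (hz : Continuous z) :
    Continuous fun t => legDiff s (α t) (β t) (γ t) (q t) (x t) (y t) (z t) :=
  (hs.continuous_legProd hα hβ hγ hq hx hy hz).sub
    (hs.continuous_legProd hα.neg hβ.neg hγ.neg hq hx hy hz)

/-- The three-leg polynomial `legDiff / s (2 * q)` is symmetric in the two ends of the leg with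
parameter `α`. -/
theorem legDiff_symm (hs : IsSigmaLike s) {α β γ : ℂ} (h : α + β + γ = 0) (q x y z : ℂ) :
    s (2 * x) * legDiff s α β γ q x y z = s (2 * q) * legDiff s α γ β x q y z := by
  obtain rfl : α = -β - γ := by linear_combination h
  have hc := hs.continuous
  -- Shifting $\beta$, $\gamma$, $q$ by a common small $t$, with $\alpha$ adjusted to keep the sum
  -- zero, makes the cleared factors nonzero; continuity gives $t=0$.
  have := eq_of_eventually_punctured
    (F := fun t => s (2 * x) * legDiff s (-(β + t) - (γ + t)) (β + t) (γ + t) (q + t) x y z)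
    (G := fun t => s (2 * (q + t)) * legDiff s (-(β + t) - (γ + t)) (γ + t) (β + t) x (q + t) y z)
    (continuous_const.mul (hs.continuous_legDiff (by fun_prop) (by fun_prop) (by fun_prop)
      (by fun_prop) (by fun_prop) (by fun_prop) (by fun_prop)))
    ((by fun_prop : Continuous fun t => s (2 * (q + t))).mul
      (hs.continuous_legDiff (by fun_prop) (by fun_prop) (by fun_prop)
      (by fun_prop) (by fun_prop) (by fun_prop) (by fun_prop))) ?_
  · simpa using this
  · filter_upwards [hs.eventually_ne_zero q, hs.eventually_ne_zero β, hs.eventually_ne_zero γ]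
      with t h1 h2 h3
    exact mul_left_cancel₀ (by positivity)
      (hs.legDiff_symm_mul (β + t) (γ + t) (q + t) x y z)

/-- The three-leg identity gives $s(2x)(N-D)=0$, and $x$ may be moved off the zeros of $s(2x)$.
Hence finiteness of a flow already forces $s(2q)\ne0$. -/
theorem legDiff_eq_zero (hs : IsSigmaLike s) {α β γ : ℂ} (h : α + β + γ = 0) {q : ℂ}
    (hq : s (2 * q) = 0) (x y z : ℂ) : legDiff s α β γ q x y z = 0 := by
  have := eq_of_eventually_punctured (F := fun t => legDiff s α β γ q (x + t) y z)
    (G := fun _ => 0) (hs.continuous_legDiff (by fun_prop) (by fun_prop) (by fun_prop)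
      (by fun_prop) (by fun_prop) (by fun_prop) (by fun_prop)) continuous_const ?_
  · simpa using this
  · filter_upwards [hs.eventually_ne_zero x] with t ht
    have := hs.legDiff_symm h q (x + t) y z
    rw [hq, zero_mul] at this
    exact (mul_eq_zero.mp this).resolve_left ht

theorem ne_zero_of_legDiff (hs : IsSigmaLike s) {α β γ : ℂ} (h : α + β + γ = 0) {q x y z : ℂ}
    (hR : legDiff s α β γ q x y z ≠ 0) : s (2 * q) ≠ 0 :=
  fun hq => hR (hs.legDiff_eq_zero h hq x y z)

end IsSigmaLike

end

/-! ### Logarithmic derivatives of the three-leg identity. -/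

section

/-- All four `s`-factors of `factor s q p α` are nonzero. -/
def EdgeRegular (s : ℂ → ℂ) (α q p : ℂ) : Prop :=
  s (q + p + α) ≠ 0 ∧ s (q - p + α) ≠ 0 ∧ s (q + p - α) ≠ 0 ∧ s (q - p - α) ≠ 0

/-- The derivative of `log (factor s q p α)` with respect to `q`. -/
def dFst (s : ℂ → ℂ) (α q p : ℂ) : ℂ :=
  logDeriv s (q + p + α) + logDeriv s (q - p + α) - logDeriv s (q + p - α) - logDeriv s (q - p - α)

/-- The derivative of `log (factor s q p α)` with respect to `p`. -/
def dSnd (s : ℂ → ℂ) (α q p : ℂ) : ℂ :=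
  logDeriv s (q + p + α) - logDeriv s (q - p + α) - logDeriv s (q + p - α) + logDeriv s (q - p - α)

/-- The derivative with respect to `q` of the logarithm of the product of the numerator and the
denominator of `factor s q p α`. -/
def dEdge (s : ℂ → ℂ) (α q p : ℂ) : ℂ :=
  logDeriv s (q + p + α) + logDeriv s (q - p + α) + logDeriv s (q + p - α) + logDeriv s (q - p - α)

/-- The solution `v` of `(v + 1) / (v - 1) = f(q,x;α) f(q,y;β) f(q,z;γ)`. -/
def legVelocity (s : ℂ → ℂ) (α β γ q x y z : ℂ) : ℂ :=
  (legProd s α β γ q x y z + legProd s (-α) (-β) (-γ) q x y z) / legDiff s α β γ q x y z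

theorem EdgeRegular.neg {s : ℂ → ℂ} {α q p : ℂ} (h : EdgeRegular s α q p) :
    EdgeRegular s (-α) q p := by
  obtain ⟨h1, h2, h3, h4⟩ := h
  simp only [EdgeRegular, sub_neg_eq_add, ← sub_eq_add_neg]
  exact ⟨h3, h4, h1, h2⟩

theorem EdgeRegular.bracket_ne_zero {s : ℂ → ℂ} {α q p : ℂ} (h : EdgeRegular s α q p) :
    bracket s (q + α) p ≠ 0 := by
  obtain ⟨h1, h2, h3, h4⟩ := h
  simp only [bracket]
  rw [show q + α + p = q + p + α by ring, show q + α - p = q - p + α by ring]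
  exact mul_ne_zero h1 h2

namespace IsSigmaLike

variable {s : ℂ → ℂ}

theorem logDeriv_neg (hs : IsSigmaLike s) (x : ℂ) : logDeriv s (-x) = -logDeriv s x := by
  have h : deriv s (-x) = deriv s x := by
    have h1 : (fun y => s (-y)) = fun y => -s y := funext hs.odd
    have h2 := deriv_comp_neg (f := s) (-x)
    rw [h1, neg_neg] at h2
    simp only [deriv.fun_neg] at h2
    linear_combination -h2
  rw [logDeriv_apply, logDeriv_apply, h, hs.odd, div_neg]

theorem edgeRegular_symm (hs : IsSigmaLike s) {α q p : ℂ} (h : EdgeRegular s α q p) :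
    EdgeRegular s α p q := by
  obtain ⟨h1, h2, h3, h4⟩ := h
  refine ⟨?_, ?_, ?_, ?_⟩
  · rwa [add_comm p]
  · rwa [show p - q + α = -(q - p - α) by ring, hs.odd, neg_ne_zero]
  · rwa [add_comm p]
  · rwa [show p - q - α = -(q - p + α) by ring, hs.odd, neg_ne_zero]

theorem hasDerivAt_comp (hs : IsSigmaLike s) {u : ℂ → ℂ} {u' t : ℂ} (hu : HasDerivAt u u' t)
    (h : s (u t) ≠ 0) : HasDerivAt (fun t => s (u t)) (s (u t) * logDeriv s (u t) * u') t := by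
  convert! (hs.differentiable (u t)).hasDerivAt.comp t hu using 1
  rw [logDeriv_apply, mul_div_cancel₀ _ h]

theorem hasDerivAt_bracket (hs : IsSigmaLike s) {u w : ℂ → ℂ} {u' w' t α : ℂ}
    (hu : HasDerivAt u u' t) (hw : HasDerivAt w w' t) (h1 : s (u t + w t + α) ≠ 0)
    (h2 : s (u t - w t + α) ≠ 0) :
    HasDerivAt (fun t => bracket s (u t + α) (w t)) (bracket s (u t + α) (w t) *
      ((logDeriv s (u t + w t + α) + logDeriv s (u t - w t + α)) * u' +
        (logDeriv s (u t + w t + α) - logDeriv s (u t - w t + α)) * w')) t := by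
  have e (t) : bracket s (u t + α) (w t) = s (u t + w t + α) * s (u t - w t + α) := by
    simp only [bracket]; ring_nf
  simp only [e]
  convert! (hs.hasDerivAt_comp ((hu.add hw).add_const α) h1).mul
    (hs.hasDerivAt_comp ((hu.sub hw).add_const α) h2) using 1
  simp only [Pi.add_apply, Pi.sub_apply]
  ring

theorem hasDerivAt_factor (hs : IsSigmaLike s) {u w : ℂ → ℂ} {u' w' t α : ℂ}
    (hu : HasDerivAt u u' t) (hw : HasDerivAt w w' t) (h : EdgeRegular s α (u t) (w t)) :
    HasDerivAt (fun t => factor s (u t) (w t) α) (factor s (u t) (w t) α *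
      (dFst s α (u t) (w t) * u' + dSnd s α (u t) (w t) * w')) t := by
  have hN := hs.hasDerivAt_bracket hu hw h.1 h.2.1
  have hD := hs.hasDerivAt_bracket hu hw h.neg.1 h.neg.2.1
  simp only [factor_eq_bracket, sub_eq_add_neg]
  have h0 := h.neg.bracket_ne_zero
  convert! hN.div hD h0 using 1
  simp only [dFst, dSnd, ← sub_eq_add_neg] at h0 ⊢
  field_simp
  ring

/-- The logarithmic derivatives of $N$ and $D$ are half the sum and half the difference of the
`dEdge` and `dFst` terms. This form displays the velocity $(N+D)/(N-D)$ after division by $N-D$. -/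
theorem hasDerivAt_legDiff_fst (hs : IsSigmaLike s) {α β γ q x y z : ℂ}
    (hx : EdgeRegular s α q x) (hy : EdgeRegular s β q y) (hz : EdgeRegular s γ q z) :
    HasDerivAt (fun q => legDiff s α β γ q x y z)
      ((legProd s α β γ q x y z + legProd s (-α) (-β) (-γ) q x y z) / 2 *
          (dFst s α q x + dFst s β q y + dFst s γ q z) +
        legDiff s α β γ q x y z / 2 * (dEdge s α q x + dEdge s β q y + dEdge s γ q z)) q := by
  have P {α β γ : ℂ} (hx : EdgeRegular s α q x) (hy : EdgeRegular s β q y)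
      (hz : EdgeRegular s γ q z) :=
    ((hs.hasDerivAt_bracket (hasDerivAt_id q) (hasDerivAt_const q x) hx.1 hx.2.1).mul
      (hs.hasDerivAt_bracket (hasDerivAt_id q) (hasDerivAt_const q y) hy.1 hy.2.1)).mul
      (hs.hasDerivAt_bracket (hasDerivAt_id q) (hasDerivAt_const q z) hz.1 hz.2.1)
  convert! (P hx hy hz).sub (P hx.neg hy.neg hz.neg) using 1
  simp only [dFst, dEdge, legDiff, legProd, Pi.mul_apply, id, ← sub_eq_add_neg]
  ring

theorem hasDerivAt_legDiff_snd (hs : IsSigmaLike s) {α β γ q x y z : ℂ}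
    (hx : EdgeRegular s α q x) :
    HasDerivAt (fun x => legDiff s α β γ q x y z)
      ((legProd s α β γ q x y z + legProd s (-α) (-β) (-γ) q x y z) / 2 * dSnd s α x q +
        legDiff s α β γ q x y z / 2 * dEdge s α x q) x := by
  have P {α : ℂ} (β γ : ℂ) (hx : EdgeRegular s α q x) :=
    ((hs.hasDerivAt_bracket (hasDerivAt_const x q) (hasDerivAt_id x) hx.1 hx.2.1).mul_const
      (bracket s (q + β) y)).mul_const (bracket s (q + γ) z)
  convert! (P β γ hx).sub (P (-β) (-γ) hx.neg) using 1
  -- Oddness of `logDeriv s` makes `dSnd` symmetric in its two arguments, so it may be written from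
  -- the far end of the leg.
  have o1 : logDeriv s (x - q + α) = -logDeriv s (q - x - α) := by
    rw [← hs.logDeriv_neg]; ring_nf
  have o2 : logDeriv s (x - q - α) = -logDeriv s (q - x + α) := by
    rw [← hs.logDeriv_neg]; ring_nf
  simp only [dSnd, dEdge, legDiff, legProd, id, ← sub_eq_add_neg, o1, o2, add_comm x]
  ring

theorem hasDerivAt_legDiff_thd (hs : IsSigmaLike s) {α β γ q x y z : ℂ}
    (hy : EdgeRegular s β q y) :
    HasDerivAt (fun y => legDiff s α β γ q x y z)
      ((legProd s α β γ q x y z + legProd s (-α) (-β) (-γ) q x y z) / 2 * dSnd s β y q +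
        legDiff s α β γ q x y z / 2 * dEdge s β y q) y := by
  have e (α β γ y : ℂ) : legProd s α β γ q x y z = legProd s β α γ q y x z := by
    simp only [legProd]; ring
  simp only [legDiff, e]
  exact hs.hasDerivAt_legDiff_snd hy

/-- The velocities at the ends of the short diagonal of a rhombus, weighted by the derivatives of
the legs to a third vertex, have a sum that does not depend on the fourth vertex. -/
theorem legVelocity_diagonal (hs : IsSigmaLike s) {α β γ q x y z : ℂ} (h : α + β + γ = 0)
    (hq : EdgeRegular s β q y) (hx : EdgeRegular s γ x y)
    (hRq : legDiff s α β γ q x y z ≠ 0) (hRx : legDiff s α γ β x q y z ≠ 0) :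
    dSnd s β y q * legVelocity s α β γ q x y z + dEdge s β y q =
      dSnd s γ y x * legVelocity s α γ β x q y z + dEdge s γ y x := by
  -- Both sides of the three-leg identity are differentiated in the third vertex $y$, on which
  -- neither $s(2x)$ nor $s(2q)$ depends.
  have h1 := (hs.hasDerivAt_legDiff_thd (α := α) (γ := γ) (x := x) (z := z) hq).const_mul
    (s (2 * x))
  have h2 := (hs.hasDerivAt_legDiff_thd (α := α) (γ := β) (x := q) (z := z) hx).const_mul
    (s (2 * q))
  rw [show (fun y => s (2 * x) * legDiff s α β γ q x y z) =
    fun y => s (2 * q) * legDiff s α γ β x q y z from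
      funext fun y => hs.legDiff_symm h q x y z] at h1
  have h3 := h1.unique h2
  have h4 := hs.legDiff_symm h q x y z
  have hq0 := hs.ne_zero_of_legDiff h hRq
  have hx0 := hs.ne_zero_of_legDiff (by linear_combination h) hRx
  simp only [legVelocity]
  set A := legProd s α β γ q x y z + legProd s (-α) (-β) (-γ) q x y z
  set B := legProd s α γ β x q y z + legProd s (-α) (-γ) (-β) x q y z
  set R := legDiff s α β γ q x y z
  set R' := legDiff s α γ β x q y z
  field_simp
  have h5 : s (2 * x) * ((dSnd s β y q * A + R * dEdge s β y q) * R') =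
      s (2 * x) * (R * (dSnd s γ y x * B + R' * dEdge s γ y x)) := by
    linear_combination 2 * R' * h3 - (dSnd s γ y x * B + R' * dEdge s γ y x) * h4
  exact mul_left_cancel₀ hx0 h5

/-- The relation between the velocities at the two ends of a leg. -/
theorem legVelocity_leg (hs : IsSigmaLike s) {α β γ q x y z : ℂ} (h : α + β + γ = 0)
    (hx : EdgeRegular s α q x) (hy : EdgeRegular s β q y) (hz : EdgeRegular s γ q z)
    (hRq : legDiff s α β γ q x y z ≠ 0) (hRx : legDiff s α γ β x q y z ≠ 0) :
    legVelocity s α β γ q x y z * (dFst s α q x + dFst s β q y + dFst s γ q z) -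
      dSnd s α q x * legVelocity s α γ β x q y z + dEdge s β q y + dEdge s γ q z =
      4 * logDeriv s (2 * q) := by
  have hq0 := hs.ne_zero_of_legDiff h hRq
  have hx0 := hs.ne_zero_of_legDiff (by linear_combination h) hRx
  -- Now the derivative is taken in $q$, an end of the leg. The factor $s(2q)$ produces the term
  -- $4\,(\log s)'(2q)$, and the `dEdge` term of the leg itself cancels.
  have h1 := (hs.hasDerivAt_legDiff_fst hx hy hz).const_mul (s (2 * x))
  have h2 := (hs.hasDerivAt_comp ((hasDerivAt_id q).const_mul 2) hq0).mul
    (hs.hasDerivAt_legDiff_snd (α := α) (β := γ) (γ := β) (y := y) (z := z)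
      (hs.edgeRegular_symm hx))
  rw [show (fun q => s (2 * x) * legDiff s α β γ q x y z) =
    (fun q => s (2 * q)) * fun q => legDiff s α γ β x q y z from
      funext fun q => hs.legDiff_symm h q x y z] at h1
  have h3 := h1.unique h2
  have h4 := hs.legDiff_symm h q x y z
  simp only [legVelocity, id, mul_one] at h3 ⊢
  set A := legProd s α β γ q x y z + legProd s (-α) (-β) (-γ) q x y z
  set B := legProd s α γ β x q y z + legProd s (-α) (-γ) (-β) x q y z
  set R := legDiff s α β γ q x y z
  set R' := legDiff s α γ β x q y z
  field_simp
  refine mul_left_cancel₀ hx0 ?_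
  linear_combination 2 * R' * h3 - (4 * R' * logDeriv s (2 * q) + dSnd s α q x * B +
    R' * dEdge s α q x) * h4

/-- The form `bracket` on the second arguments of two legs, as a function of the common first
argument, is proportional to `s (2 * q)`. -/
theorem bracket_cross (hs : IsSigmaLike s) (q γ x y : ℂ) :
    bracket s (q + γ) y * bracket s (q - γ) x - bracket s (q - γ) y * bracket s (q + γ) x =
      s (2 * q) * (s (2 * γ) * bracket s y x) := by
  rw [hs.pluecker]
  simp only [bracket]; ring_nf

/-- The logarithmic derivative in $q$ of `bracket_cross`, whose right-hand side depends on $q$ only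
through $s(2q)$. -/
theorem bracket_cross_deriv (hs : IsSigmaLike s) {q γ x y : ℂ} (hq : s (2 * q) ≠ 0)
    (hx : EdgeRegular s γ q x) (hy : EdgeRegular s γ q y) :
    (factor s q y γ + factor s q x γ) * (dFst s γ q y - dFst s γ q x) +
      (factor s q y γ - factor s q x γ) *
        (dEdge s γ q y + dEdge s γ q x - 4 * logDeriv s (2 * q)) = 0 := by
  have P {γ w : ℂ} (h : EdgeRegular s γ q w) :=
    hs.hasDerivAt_bracket (hasDerivAt_id q) (hasDerivAt_const q w) h.1 h.2.1
  have h1 := ((P hy).mul (P hx.neg)).sub ((P hy.neg).mul (P hx))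
  have h2 := (hs.hasDerivAt_comp ((hasDerivAt_id q).const_mul 2) hq).mul_const
    (s (2 * γ) * bracket s y x)
  have h3 := h1.unique (h2.congr_of_eventuallyEq (Eventually.of_forall fun q => by
    simpa [← sub_eq_add_neg] using hs.bracket_cross q γ x y))
  have h4 := hs.bracket_cross q γ x y
  have n1 := hx.neg.bracket_ne_zero
  have n2 := hy.neg.bracket_ne_zero
  simp only [← sub_eq_add_neg, id, mul_one] at h3 n1 n2
  simp only [factor_eq_bracket, dFst, dEdge]
  generalize logDeriv s (2 * q) = Z at h3 ⊢
  field_simp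
  linear_combination 2 * h3 + 4 * Z * (-h4)

end IsSigmaLike

end

/-! ### The flows on the lattice: rhombi and relations between velocities. -/

section

/-- `i`, `j`, `k` are the three elements of `Fin 3` in some order. -/
def IsTriple (i j k : Fin 3) : Prop := i ≠ j ∧ j ≠ k ∧ i ≠ k

theorem exists_isTriple (i : Fin 3) : ∃ j k, IsTriple i j k := by
  unfold IsTriple; revert i; decide

theorem exists_isTriple_of_ne {i j : Fin 3} (h : i ≠ j) : ∃ k, IsTriple i j k := by
  unfold IsTriple; revert i j; decide

theorem IsTriple.swap {i j k : Fin 3} (h : IsTriple i j k) : IsTriple i k j :=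
  ⟨h.2.2, h.2.1.symm, h.1⟩

theorem IsTriple.swap_left {i j k : Fin 3} (h : IsTriple i j k) : IsTriple j i k :=
  ⟨h.1.symm, h.2.2, h.2.1⟩

theorem IsTriple.dir_add {i j k : Fin 3} (h : IsTriple i j k) : dir i + dir j + dir k = 0 := by
  unfold IsTriple at h; revert i j k; decide

theorem IsTriple.cases {p : Fin 3 → Fin 3 → Fin 3 → Prop} (h1 : p 0 1 2) (h2 : p 0 2 1)
    (h3 : p 1 0 2) (h4 : p 1 2 0) (h5 : p 2 0 1) (h6 : p 2 1 0) {i j k : Fin 3}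
    (h : IsTriple i j k) : p i j k := by
  obtain ⟨hij, hjk, hik⟩ := h
  fin_cases i <;> fin_cases j <;> fin_cases k <;> first | assumption | simp at hij hjk hik

theorem IsTriple.sum {M : Type*} [AddCommMonoid M] (f : Fin 3 → M) {i j k : Fin 3}
    (h : IsTriple i j k) : ∑ m, f m = f i + f j + f k := by
  rw [Fin.sum_univ_three]
  revert i j k
  apply IsTriple.cases <;> abel

variable {s : ℂ → ℂ} {a : Fin 3 → ℂ} {q : Field} {n : ℤ × ℤ} {i j k : Fin 3}

theorem sub_dir_zero (n : ℤ × ℤ) : n - dir 0 = n + (-1, 0) := by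
  simp [sub_eq_add_neg, dir]

theorem sub_dir_one (n : ℤ × ℤ) : n - dir 1 = n + (0, -1) := by
  simp [sub_eq_add_neg, dir]

theorem sub_dir_two (n : ℤ × ℤ) : n - dir 2 = n + (1, 1) := by
  simp [sub_eq_add_neg, dir]

/-- This uniform form, with legs along $+i$, $-j$, $-k$, allows all three flows to be treated at
once. -/
theorem flowProd_eq (h : IsTriple i j k) : flowProd s a i q n =
    factor s (q n) (q (n + dir i)) (a i) * factor s (q n) (q (n - dir j)) (a j) *
      factor s (q n) (q (n - dir k)) (a k) := by
  revert i j k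
  apply IsTriple.cases <;> simp only [flowProd, sub_dir_zero, sub_dir_one, sub_dir_two] <;>
    simp only [dir, Matrix.cons_val] <;> ring

theorem flowProd'_eq (h : IsTriple i j k) : flowProd' s a i q n =
    factor s (q n) (q (n - dir i)) (-a i) * factor s (q n) (q (n + dir j)) (-a j) *
      factor s (q n) (q (n + dir k)) (-a k) := by
  revert i j k
  apply IsTriple.cases <;> simp only [flowProd', sub_dir_zero, sub_dir_one, sub_dir_two] <;>
    simp only [dir, Matrix.cons_val] <;> ring

theorem eqProd_eq (h : IsTriple i j k) : eqProd s a q n =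
    (factor s (q n) (q (n + dir i)) (a i) * factor s (q n) (q (n - dir j)) (a j) *
      factor s (q n) (q (n - dir k)) (a k)) *
    (factor s (q n) (q (n - dir i)) (a i) * factor s (q n) (q (n + dir j)) (a j) *
      factor s (q n) (q (n + dir k)) (a k)) := by
  revert i j k
  apply IsTriple.cases <;> simp only [eqProd, sub_dir_zero, sub_dir_one, sub_dir_two] <;>
    simp only [dir, Matrix.cons_val] <;> ring

theorem IsRegularAt.add (h : IsRegularAt s a q n) (k : Fin 3) :
    EdgeRegular s (a k) (q n) (q (n + dir k)) :=
  h k _ (Or.inl rfl)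

theorem IsRegularAt.sub (h : IsRegularAt s a q n) (k : Fin 3) :
    EdgeRegular s (a k) (q n) (q (n - dir k)) := by
  rw [sub_eq_add_neg]
  exact h k _ (Or.inr rfl)

theorem factor_neg (s : ℂ → ℂ) (q p α : ℂ) : factor s q p (-α) = (factor s q p α)⁻¹ := by
  simp only [factor, sub_neg_eq_add, ← sub_eq_add_neg, inv_div]

theorem factor_mul (s : ℂ → ℂ) (α β γ q x y z : ℂ) :
    factor s q x α * factor s q y β * factor s q z γ =
      legProd s α β γ q x y z / legProd s (-α) (-β) (-γ) q x y z := by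
  simp only [factor_eq_bracket, legProd, ← sub_eq_add_neg, div_mul_div_comm]

theorem EdgeRegular.factor_ne_zero {α q p : ℂ} (h : EdgeRegular s α q p) :
    factor s q p α ≠ 0 :=
  div_ne_zero (mul_ne_zero h.1 h.2.1) (mul_ne_zero h.2.2.1 h.2.2.2)

theorem legProd_ne_zero {α β γ q x y z : ℂ} (hx : EdgeRegular s α q x) (hy : EdgeRegular s β q y)
    (hz : EdgeRegular s γ q z) : legProd s α β γ q x y z ≠ 0 :=
  mul_ne_zero (mul_ne_zero hx.bracket_ne_zero hy.bracket_ne_zero) hz.bracket_ne_zero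

theorem IsSolutionAt.flowProd_mul (h : IsSolutionAt s a q n) (ht : IsTriple i j k) :
    flowProd s a i q n * (factor s (q n) (q (n - dir i)) (a i) *
      factor s (q n) (q (n + dir j)) (a j) * factor s (q n) (q (n + dir k)) (a k)) = 1 := by
  rw [flowProd_eq ht, ← eqProd_eq ht, h.2]

theorem legDiff_ne_zero_of_factor {α β γ q x y z : ℂ} (hx : EdgeRegular s α q x)
    (hy : EdgeRegular s β q y) (hz : EdgeRegular s γ q z)
    (h : factor s q x α * factor s q y β * factor s q z γ ≠ 1) : legDiff s α β γ q x y z ≠ 0 := by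
  rw [factor_mul, Ne, div_eq_one_iff_eq (legProd_ne_zero hx.neg hy.neg hz.neg)] at h
  exact sub_ne_zero.mpr h

theorem legVelocity_eq {α β γ q x y z : ℂ} (hx : EdgeRegular s α q x)
    (hy : EdgeRegular s β q y) (hz : EdgeRegular s γ q z) :
    legVelocity s α β γ q x y z = (factor s q x α * factor s q y β * factor s q z γ + 1) /
      (factor s q x α * factor s q y β * factor s q z γ - 1) := by
  have hD := legProd_ne_zero hx.neg hy.neg hz.neg
  rw [factor_mul, legVelocity, legDiff, div_add_one hD, div_sub_one hD,
    div_div_div_cancel_right₀ hD]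

theorem IsFlowPoint.legDiff_fst (h : IsFlowPoint s a i q n) (ht : IsTriple i j k) :
    legDiff s (a i) (a j) (a k) (q n) (q (n + dir i)) (q (n - dir j)) (q (n - dir k)) ≠ 0 :=
  legDiff_ne_zero_of_factor (h.1.1.add i) (h.1.1.sub j) (h.1.1.sub k) (flowProd_eq ht ▸ h.2)

theorem IsFlowPoint.velocity_fst (h : IsFlowPoint s a i q n) (ht : IsTriple i j k) :
    velocity s a i q n = legVelocity s (a i) (a j) (a k) (q n) (q (n + dir i)) (q (n - dir j))
      (q (n - dir k)) := by
  rw [legVelocity_eq (h.1.1.add i) (h.1.1.sub j) (h.1.1.sub k), ← flowProd_eq ht, velocity]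

theorem IsFlowPoint.legDiff_snd (h : IsFlowPoint s a i q n) (ht : IsTriple i j k) :
    legDiff s (a i) (a j) (a k) (q n) (q (n - dir i)) (q (n + dir j)) (q (n + dir k)) ≠ 0 := by
  refine legDiff_ne_zero_of_factor (h.1.1.sub i) (h.1.1.add j) (h.1.1.add k) fun h1 => h.2 ?_
  simpa [h1] using h.1.flowProd_mul ht

/-- On solutions the products over the two complementary triples of edges are mutually inverse, and
$P\mapsto P^{-1}$ changes the sign of $(P+1)/(P-1)$. So the velocity at $n$ can also be read from
the rhombus behind $n$. -/
theorem IsFlowPoint.velocity_snd (h : IsFlowPoint s a i q n) (ht : IsTriple i j k) :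
    velocity s a i q n = -legVelocity s (a i) (a j) (a k) (q n) (q (n - dir i)) (q (n + dir j))
      (q (n + dir k)) := by
  rw [legVelocity_eq (h.1.1.sub i) (h.1.1.add j) (h.1.1.add k), velocity]
  have h1 := h.1.flowProd_mul ht
  have h2 := h.2
  generalize factor s (q n) (q (n - dir i)) (a i) *
      factor s (q n) (q (n + dir j)) (a j) * factor s (q n) (q (n + dir k)) (a k) = P at h1 ⊢
  have hP : P ≠ 0 := right_ne_zero_of_mul_eq_one h1
  obtain h3 : flowProd s a i q n = P⁻¹ := eq_inv_of_mul_eq_one_left h1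
  rw [h3] at h2 ⊢
  have h4 : P - 1 ≠ 0 := fun h => h2 (by rw [sub_eq_zero.mp h, inv_one])
  have h5 : 1 - P ≠ 0 := fun h => h4 (by linear_combination -h)
  rw [show P⁻¹ + 1 = (1 + P) / P by field_simp, show P⁻¹ - 1 = (1 - P) / P by field_simp,
    div_div_div_cancel_right₀ hP]
  field_simp
  ring

theorem IsTriple.param_add (ha : a 0 + a 1 + a 2 = 0) (ht : IsTriple i j k) :
    a i + a j + a k = 0 := by
  rw [← ht.sum, Fin.sum_univ_three, ha]

theorem IsTriple.add_dir (ht : IsTriple i j k) (n : ℤ × ℤ) : n + dir i + dir j = n - dir k := by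
  have := ht.dir_add
  rw [eq_sub_iff_add_eq, add_assoc, add_assoc, ← add_assoc (dir i), this, add_zero]

theorem IsTriple.sub_dir (ht : IsTriple i j k) (n : ℤ × ℤ) : n - dir i - dir j = n + dir k := by
  have := ht.dir_add
  rw [sub_eq_iff_eq_add, sub_eq_iff_eq_add, add_assoc, add_assoc, add_comm (dir k),
    add_comm (dir j), this, add_zero]

/-- The rhombus with short diagonal from $n$ to $n+\mathrm{dir}\,i$: the first form of the flow is
used at $n$ and the second at the other end. -/
theorem legVelocity_add (hs : IsSigmaLike s) (ha : a 0 + a 1 + a 2 = 0) (ht : IsTriple i j k)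
    (h0 : IsFlowPoint s a i q n) (h1 : IsFlowPoint s a i q (n + dir i)) :
    velocity s a i q n * (dFst s (a i) (q n) (q (n + dir i)) +
        dFst s (a j) (q n) (q (n - dir j)) + dFst s (a k) (q n) (q (n - dir k))) +
      dSnd s (a i) (q n) (q (n + dir i)) * velocity s a i q (n + dir i) +
      dEdge s (a j) (q n) (q (n - dir j)) + dEdge s (a k) (q n) (q (n - dir k)) =
      4 * logDeriv s (2 * q n) := by
  have e := h1.legDiff_snd ht.swap
  have v := h1.velocity_snd ht.swap
  rw [add_sub_cancel_right, ht.add_dir, ht.swap.add_dir] at e v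
  rw [h0.velocity_fst ht, v, ← hs.legVelocity_leg (ht.param_add ha) (h0.1.1.add i) (h0.1.1.sub j)
    (h0.1.1.sub k) (h0.legDiff_fst ht) e]
  ring

theorem legVelocity_sub (hs : IsSigmaLike s) (ha : a 0 + a 1 + a 2 = 0) (ht : IsTriple i j k)
    (h0 : IsFlowPoint s a i q n) (h1 : IsFlowPoint s a i q (n - dir i)) :
    -velocity s a i q n * (dFst s (a i) (q n) (q (n - dir i)) +
        dFst s (a j) (q n) (q (n + dir j)) + dFst s (a k) (q n) (q (n + dir k))) -
      dSnd s (a i) (q n) (q (n - dir i)) * velocity s a i q (n - dir i) +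
      dEdge s (a j) (q n) (q (n + dir j)) + dEdge s (a k) (q n) (q (n + dir k)) =
      4 * logDeriv s (2 * q n) := by
  have e := h1.legDiff_fst ht.swap
  have v := h1.velocity_fst ht.swap
  rw [sub_add_cancel, ht.sub_dir, ht.swap.sub_dir] at e v
  rw [h0.velocity_snd ht, v, ← hs.legVelocity_leg (ht.param_add ha) (h0.1.1.sub i) (h0.1.1.add j)
    (h0.1.1.add k) (h0.legDiff_snd ht) e]
  ring

/-- The sites $n+\mathrm{dir}\,j$ and $n-\mathrm{dir}\,k$ differ by $\mathrm{dir}\,i$, so they are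
the ends of the short diagonal of a rhombus that has $n$ as third vertex. -/
theorem legVelocity_pair (hs : IsSigmaLike s) (ha : a 0 + a 1 + a 2 = 0) (ht : IsTriple i j k)
    (hn : IsRegularAt s a q n) (h0 : IsFlowPoint s a i q (n + dir j))
    (h1 : IsFlowPoint s a i q (n - dir k)) :
    dSnd s (a j) (q n) (q (n + dir j)) * velocity s a i q (n + dir j) +
      dSnd s (a k) (q n) (q (n - dir k)) * velocity s a i q (n - dir k) =
    dEdge s (a k) (q n) (q (n - dir k)) - dEdge s (a j) (q n) (q (n + dir j)) := by
  have e0 := h0.legDiff_fst ht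
  have v0 := h0.velocity_fst ht
  have e1 := h1.legDiff_snd ht.swap
  have v1 := h1.velocity_snd ht.swap
  have c1 : n - dir k - dir i = n + dir j := ht.swap.swap_left.sub_dir n
  have c2 : n - dir k + dir k = n := sub_add_cancel _ _
  have c3 : n - dir k + dir j = n + dir j - dir k := by abel
  have c4 : n + dir j + dir i = n - dir k := ht.swap_left.add_dir n
  rw [c1, c2, c3] at e1 v1
  rw [c4, add_sub_cancel_right] at e0 v0
  have := hs.legVelocity_diagonal (ht.param_add ha) (hs.edgeRegular_symm (hn.add j))
    (hs.edgeRegular_symm (hn.sub k)) e0 e1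
  rw [v0, v1]
  linear_combination this

/-! ### Linearisation along a vector field: consistency and commutativity. -/

theorem hasDerivAt_line (q v : Field) (m : ℤ × ℤ) :
    HasDerivAt (fun t : ℂ => (q + t • v) m) (v m) 0 := by
  simpa using ((hasDerivAt_id (0 : ℂ)).mul_const (v m)).const_add (q m)

theorem hasDerivAt_factor_line (hs : IsSigmaLike s) {α : ℂ} {m : ℤ × ℤ} (v : Field)
    (h : EdgeRegular s α (q n) (q m)) :
    HasDerivAt (fun t : ℂ => factor s ((q + t • v) n) ((q + t • v) m) α)
      (factor s (q n) (q m) α *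
        (dFst s α (q n) (q m) * v n + dSnd s α (q n) (q m) * v m)) 0 := by
  have := hs.hasDerivAt_factor (α := α) (hasDerivAt_line q v n) (hasDerivAt_line q v m)
    (by simpa using h)
  simpa using this

/-- The logarithmic derivative of `flowProd` along a vector field. -/
def dFlow (s : ℂ → ℂ) (a : Fin 3 → ℂ) (i j k : Fin 3) (q v : Field) (n : ℤ × ℤ) : ℂ :=
  v n * (dFst s (a i) (q n) (q (n + dir i)) + dFst s (a j) (q n) (q (n - dir j)) +
      dFst s (a k) (q n) (q (n - dir k))) +
    dSnd s (a i) (q n) (q (n + dir i)) * v (n + dir i) +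
    dSnd s (a j) (q n) (q (n - dir j)) * v (n - dir j) +
    dSnd s (a k) (q n) (q (n - dir k)) * v (n - dir k)

theorem hasDerivAt_flowProd (hs : IsSigmaLike s) (ht : IsTriple i j k) (v : Field)
    (h : IsRegularAt s a q n) :
    HasDerivAt (fun t : ℂ => flowProd s a i (q + t • v) n)
      (flowProd s a i q n * dFlow s a i j k q v n) 0 := by
  simp only [flowProd_eq ht, dFlow]
  convert! ((hasDerivAt_factor_line hs v (h.add i)).mul
    (hasDerivAt_factor_line hs v (h.sub j))).mul (hasDerivAt_factor_line hs v (h.sub k)) using 1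
  simp only [zero_smul, add_zero, Pi.mul_apply]
  ring

theorem isConsistent (hs : IsSigmaLike s) (ha : a 0 + a 1 + a 2 = 0) (i : Fin 3) :
    IsConsistent s a i := by
  obtain ⟨j, k, ht⟩ := exists_isTriple i
  refine ⟨fun q n h => ?_, fun q n h => ?_⟩
  · have h1 : flowProd s a i q n - 1 ≠ 0 := sub_ne_zero.mpr h.2
    have h2 : velocity s a i q n - 1 = 2 / (flowProd s a i q n - 1) := by
      rw [velocity]; field_simp; ring
    have h3 : velocity s a i q n + 1 = 2 * flowProd s a i q n / (flowProd s a i q n - 1) := by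
      rw [velocity]; field_simp; ring
    have h4 : (velocity s a i q n + 1) / (velocity s a i q n - 1) = flowProd s a i q n := by
      rw [h2, h3]; field_simp
    refine ⟨sub_ne_zero.mp (h2 ▸ div_ne_zero two_ne_zero h1), h4, h4.trans ?_⟩
    rw [flowProd'_eq ht, factor_neg, factor_neg, factor_neg, ← mul_inv, ← mul_inv]
    exact eq_inv_of_mul_eq_one_left (h.1.flowProd_mul ht)
  · have h0 : IsFlowPoint s a i q n := by
      have := h 0 (by decide)
      rwa [add_zero] at this
    have hp (m : Fin 3) : IsFlowPoint s a i q (n + dir m) :=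
      h (dir m) (by revert m; decide)
    have hm (m : Fin 3) : IsFlowPoint s a i q (n - dir m) := by
      rw [sub_eq_add_neg]; exact h (-dir m) (by revert m; decide)
    have r := h0.1.1
    set v := velocity s a i q with hv
    have D := (((hasDerivAt_factor_line hs v (r.add i)).mul
      (hasDerivAt_factor_line hs v (r.sub j))).mul (hasDerivAt_factor_line hs v (r.sub k))).mul
      (((hasDerivAt_factor_line hs v (r.sub i)).mul
      (hasDerivAt_factor_line hs v (r.add j))).mul (hasDerivAt_factor_line hs v (r.add k)))
    simp only [eqProd_eq ht]
    convert! D using 1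
    -- In $e_1-e_2+e_3+e_4$ all `dEdge` terms and the two terms $4\,(\log s)'(2q)$ cancel. What
    -- remains is the logarithmic derivative of the left-hand side of (Q) along the flow.
    have e1 := legVelocity_add hs ha ht h0 (hp i)
    have e2 := legVelocity_sub hs ha ht h0 (hm i)
    have e3 := legVelocity_pair hs ha ht r (hp j) (hm k)
    have e4 := legVelocity_pair hs ha ht.swap r (hp k) (hm j)
    rw [← hv] at e1 e2 e3 e4
    simp only [zero_smul, add_zero, Pi.mul_apply]
    linear_combination (-(factor s (q n) (q (n + dir i)) (a i) *
      factor s (q n) (q (n - dir j)) (a j) * factor s (q n) (q (n - dir k)) (a k) *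
      (factor s (q n) (q (n - dir i)) (a i) * factor s (q n) (q (n + dir j)) (a j) *
      factor s (q n) (q (n + dir k)) (a k)))) * (e1 - e2 + e3 + e4)

/-- The velocities at the neighbours are eliminated: the legs $+j$ and $-k$ form a pair, and the leg
$-i$ is covered by the rhombus behind $n$. -/
theorem dFlow_velocity (hs : IsSigmaLike s) (ha : a 0 + a 1 + a 2 = 0) (ht : IsTriple i j k)
    (h0 : IsFlowPoint s a i q n) (hi : IsFlowPoint s a i q (n - dir i))
    (hj : IsFlowPoint s a i q (n + dir j)) (hk : IsFlowPoint s a i q (n - dir k)) :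
    dFlow s a j i k q (velocity s a i q) n =
      velocity s a i q n *
        (dFst s (a k) (q n) (q (n - dir k)) - dFst s (a k) (q n) (q (n + dir k))) +
      (dEdge s (a k) (q n) (q (n - dir k)) + dEdge s (a k) (q n) (q (n + dir k)) -
        4 * logDeriv s (2 * q n)) := by
  simp only [dFlow]
  linear_combination legVelocity_pair hs ha ht h0.1.1 hj hk - legVelocity_sub hs ha ht h0 hi

theorem hasDerivAt_velocity (hs : IsSigmaLike s) (ht : IsTriple i j k) (v : Field)
    (h : IsFlowPoint s a i q n) :
    HasDerivAt (fun t : ℂ => velocity s a i (q + t • v) n)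
      (-(2 * flowProd s a i q n / (flowProd s a i q n - 1) ^ 2) * dFlow s a i j k q v n) 0 := by
  have h1 : flowProd s a i q n - 1 ≠ 0 := sub_ne_zero.mpr h.2
  have D := hasDerivAt_flowProd hs ht v h.1.1
  simp only [velocity]
  convert! (D.add_const 1).div (D.sub_const 1) (by simpa using h1) using 1
  simp only [zero_smul, add_zero]
  field_simp
  ring

theorem sigma_two_mul_ne_zero (hs : IsSigmaLike s) (ha : a 0 + a 1 + a 2 = 0)
    (ht : IsTriple i j k) (hi : IsFlowPoint s a i q n) : s (2 * q n) ≠ 0 :=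
  hs.ne_zero_of_legDiff (ht.param_add ha) (hi.legDiff_fst ht)

theorem flowsCommute (hs : IsSigmaLike s) (ha : a 0 + a 1 + a 2 = 0) (i j : Fin 3) :
    FlowsCommute s a i j := by
  intro q n h
  have h0 : IsFlowPoint s a i q n ∧ IsFlowPoint s a j q n := by
      have := h 0 (by decide)
      rwa [add_zero] at this
  have hp (m : Fin 3) : IsFlowPoint s a i q (n + dir m) ∧ IsFlowPoint s a j q (n + dir m) :=
    h (dir m) (by revert m; decide)
  have hm (m : Fin 3) : IsFlowPoint s a i q (n - dir m) ∧ IsFlowPoint s a j q (n - dir m) := by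
    rw [sub_eq_add_neg]; exact h (-dir m) (by revert m; decide)
  by_cases hij : i = j
  · subst hij
    obtain ⟨j, k, ht⟩ := exists_isTriple i
    exact ⟨_, hasDerivAt_velocity hs ht _ h0.1, hasDerivAt_velocity hs ht _ h0.1⟩
  obtain ⟨k, ht⟩ := exists_isTriple_of_ne hij
  refine ⟨_, hasDerivAt_velocity hs ht.swap_left _ h0.2, ?_⟩
  convert! hasDerivAt_velocity hs ht _ h0.1 using 1
  rw [dFlow_velocity hs ha ht h0.1 (hm i).1 (hp j).1 (hm k).1,
    dFlow_velocity hs ha ht.swap_left h0.2 (hm j).2 (hp i).2 (hm k).2]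
  have c := hs.bracket_cross_deriv (sigma_two_mul_ne_zero hs ha ht h0.1) (h0.1.1.1.add k)
    (h0.1.1.1.sub k)
  have e := h0.1.1.2
  have pi := flowProd_eq (s := s) (a := a) (q := q) (n := n) ht
  have pj := flowProd_eq (s := s) (a := a) (q := q) (n := n) ht.swap_left
  have hF := (h0.1.1.1.add k).factor_ne_zero
  -- The two flow products share the leg $-k$ and together miss only the leg $+k$, so on solutions
  -- they determine the ratio of the two factors in direction $k$. This turns `bracket_cross_deriv`
  -- into a relation `c'` between the two flow products.
  have hR : flowProd s a i q n * flowProd s a j q n * factor s (q n) (q (n + dir k)) (a k) =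
      factor s (q n) (q (n - dir k)) (a k) := by
    rw [eqProd_eq ht] at e
    rw [pi, pj]
    linear_combination factor s (q n) (q (n - dir k)) (a k) * e
  have hi1 : flowProd s a i q n - 1 ≠ 0 := sub_ne_zero.mpr h0.1.2
  have hj1 : flowProd s a j q n - 1 ≠ 0 := sub_ne_zero.mpr h0.2.2
  rw [← hR] at c
  simp only [velocity]
  generalize flowProd s a i q n = P at *
  generalize flowProd s a j q n = P' at *
  generalize dEdge s (a k) (q n) (q (n - dir k)) + dEdge s (a k) (q n) (q (n + dir k)) -
        4 * logDeriv s (2 * q n) = Z at *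
  generalize dFst s (a k) (q n) (q (n - dir k)) - dFst s (a k) (q n) (q (n + dir k)) = Y at *
  generalize factor s (q n) (q (n + dir k)) (a k) = F at *
  have c' : (P * P' + 1) * Y + (P * P' - 1) * Z = 0 := by
    refine mul_left_cancel₀ hF ?_
    linear_combination c
  field_simp
  linear_combination (P' - P) * c'

end

/-! ### Local branches of the action. -/

section

variable {s : ℂ → ℂ} {a : Fin 3 → ℂ} {q : Field} {n : ℤ × ℤ} {i j k : Fin 3}

/-- Dividing by $g(u_0)$ moves the argument of the logarithm near $1$, away from the cut; on a ball
the holomorphic logarithm has a primitive. -/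
theorem exists_primitive_log {g : ℂ → ℂ} {u₀ : ℂ} (hg : AnalyticAt ℂ g u₀) (h0 : g u₀ ≠ 0) :
    ∃ U : ℂ → ℂ, AnalyticAt ℂ U u₀ ∧
      ∀ᶠ u in 𝓝 u₀, DifferentiableAt ℂ U u ∧ Complex.exp (deriv U u) = g u := by
  have hl : AnalyticAt ℂ (fun u => Complex.log (g u / g u₀) + Complex.log (g u₀)) u₀ :=
    ((hg.div_const).clog (by simp [div_self h0])).add analyticAt_const
  obtain ⟨r, hr, hd⟩ := Metric.eventually_nhds_iff_ball.mp hl.eventually_analyticAt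
  obtain ⟨U, hU⟩ := DifferentiableOn.isExactOn_ball
    (fun z hz => (hd z hz).differentiableAt.differentiableWithinAt)
  refine ⟨U, DifferentiableOn.analyticAt (s := Metric.ball u₀ r)
    (fun z hz => (hU z hz).differentiableAt.differentiableWithinAt) (Metric.ball_mem_nhds _ hr), ?_⟩
  filter_upwards [Metric.ball_mem_nhds u₀ hr, hg.continuousAt.eventually_ne h0] with u hu hu0
  refine ⟨(hU u hu).differentiableAt, ?_⟩
  rw [(hU u hu).deriv, Complex.exp_add, Complex.exp_log (div_ne_zero hu0 h0), Complex.exp_log h0,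
    div_mul_cancel₀ _ h0]

/-- `φ` is near `(x, y)` a branch of the edge function of the action: its derivatives in the first
and second argument are branches of `log f(q, p)` and `log f(p, q)`. -/
def IsEdgeBranch (s : ℂ → ℂ) (α x y : ℂ) (φ : ℂ × ℂ → ℂ) : Prop :=
  AnalyticAt ℂ φ (x, y) ∧ ∀ᶠ z in 𝓝 (x, y),
    Complex.exp (deriv (fun t : ℂ => φ (t, z.2)) z.1) = factor s z.1 z.2 α ∧
    Complex.exp (deriv (fun t : ℂ => φ (z.1, t)) z.2) = factor s z.2 z.1 α

theorem exists_isEdgeBranch (hs : IsSigmaLike s) {α x y : ℂ} (h : EdgeRegular s α x y) :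
    ∃ φ, IsEdgeBranch s α x y φ := by
  have hg (u : ℂ) (hu : s (u - α) ≠ 0) : AnalyticAt ℂ (fun u => s (u + α) / s (u - α)) u :=
    ((hs.analyticAt _).fun_comp (by fun_prop)).div ((hs.analyticAt _).fun_comp (by fun_prop)) hu
  obtain ⟨U, hU, hU'⟩ := exists_primitive_log (hg (x + y) h.2.2.1) (div_ne_zero h.1 h.2.2.1)
  obtain ⟨W, hW, hW'⟩ := exists_primitive_log (hg (x - y) h.2.2.2) (div_ne_zero h.2.1 h.2.2.2)
  have c1 : ContinuousAt (fun z : ℂ × ℂ => z.1 + z.2) (x, y) := by fun_prop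
  have c2 : ContinuousAt (fun z : ℂ × ℂ => z.1 - z.2) (x, y) := by fun_prop
  -- The factor splits into a function of $q+p$ times a function of $q-p$, so the edge function is a
  -- sum of two primitives. The sign from differentiating $q-p$ in $p$ matches oddness of $s$.
  refine ⟨fun z => U (z.1 + z.2) + W (z.1 - z.2), ?_, ?_⟩
  · exact (AnalyticAt.fun_comp (f := fun z : ℂ × ℂ => z.1 + z.2) hU (analyticAt_fst.add analyticAt_snd)).add
      (AnalyticAt.fun_comp (f := fun z : ℂ × ℂ => z.1 - z.2) hW (analyticAt_fst.sub analyticAt_snd))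
  · filter_upwards [c1.eventually hU', c2.eventually hW'] with z ⟨hz1, hz2⟩ ⟨hz3, hz4⟩
    have d1 : HasDerivAt (fun t => U (t + z.2) + W (t - z.2))
        (deriv U (z.1 + z.2) + deriv W (z.1 - z.2)) z.1 :=
      (hz1.hasDerivAt.comp_add_const z.1 z.2).fun_add (hz3.hasDerivAt.comp_sub_const z.1 z.2)
    have d2 : HasDerivAt (fun t => U (z.1 + t) + W (z.1 - t))
        (deriv U (z.1 + z.2) - deriv W (z.1 - z.2)) z.2 :=
      (hz1.hasDerivAt.comp_const_add z.1 z.2).fun_add (hz3.hasDerivAt.comp_const_sub z.1 z.2)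
    rw [d1.deriv, d2.deriv, Complex.exp_add, Complex.exp_sub, hz2, hz4]
    refine ⟨by rw [factor, div_mul_div_comm], ?_⟩
    rw [factor, show z.2 - z.1 + α = -(z.1 - z.2 - α) by ring,
      show z.2 - z.1 - α = -(z.1 - z.2 + α) by ring, hs.odd, hs.odd, add_comm z.2, div_div_div_eq]
    simp only [mul_neg, neg_div_neg_eq]

/-- Subtracting $cz_1$ with $c\in2\pi i\mathbb Z$ changes only the branch of the first logarithm. -/
theorem IsEdgeBranch.sub_linear {α x y c : ℂ} {φ : ℂ × ℂ → ℂ} (h : IsEdgeBranch s α x y φ)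
    (hc : Complex.exp c = 1) : IsEdgeBranch s α x y fun z => φ z - c * z.1 := by
  refine ⟨h.1.sub (analyticAt_const.mul analyticAt_fst), ?_⟩
  filter_upwards [h.2, h.1.eventually_analyticAt] with z ⟨h1, h2⟩ h3
  have h4 : DifferentiableAt ℂ (fun t => φ (t, z.2)) z.1 :=
    DifferentiableAt.comp (f := fun t => (t, z.2)) z.1 h3.differentiableAt (by fun_prop)
  refine ⟨?_, ?_⟩
  · rw [((h4.hasDerivAt).fun_sub ((hasDerivAt_id' z.1).const_mul c)).deriv, Complex.exp_sub, mul_one,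
      hc, div_one, h1]
  · rw [deriv_sub_const, h2]

theorem exp_variationalDerivative {q₀ : Field} {φ : ℤ × ℤ → Fin 3 → ℂ × ℂ → ℂ}
    (h : ∀ n k, IsEdgeBranch s (a k) (q₀ n) (q₀ (n - dir k)) (φ n k)) (n : ℤ × ℤ) :
    ∀ᶠ q in 𝓝 q₀, Complex.exp (variationalDerivative φ q n) = eqProd s a q n := by
  have c (m m' : ℤ × ℤ) : ContinuousAt (fun q : Field => (q m, q m')) q₀ := by fun_prop
  have e (k : Fin 3) := (c n (n - dir k)).eventually (h n k).2
  have e' (k : Fin 3) : ∀ᶠ q in 𝓝 q₀,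
      Complex.exp (deriv (fun t : ℂ => φ (n + dir k) k (q (n + dir k), t)) (q n)) =
        factor s (q n) (q (n + dir k)) (a k) := by
    have h1 := (h (n + dir k) k).2
    rw [add_sub_cancel_right] at h1
    exact ((c (n + dir k) n).eventually h1).mono fun q hq => hq.2
  filter_upwards [e 0, e 1, e 2, e' 0, e' 1, e' 2] with q h0 h1 h2 h3 h4 h5
  rw [variationalDerivative, Fin.sum_univ_three]
  simp only [Complex.exp_add, h0, h1, h2, h3, h4, h5]
  rw [eqProd_eq (i := 0) (j := 1) (k := 2) (by unfold IsTriple; decide)]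
  ring

theorem exists_isActionBranch (hs : IsSigmaLike s) (q₀ : Field)
    (h : ∀ n, IsSolutionAt s a q₀ n) : ∃ φ, IsActionBranch s a q₀ φ := by
  choose ψ hψ using fun n k => exists_isEdgeBranch hs ((h n).1.sub k)
  have hc (n : ℤ × ℤ) : Complex.exp (variationalDerivative ψ q₀ n) = 1 := by
    rw [(exp_variationalDerivative hψ n).self_of_nhds, (h n).2]
  -- At a solution the variational derivative of an arbitrary choice lies in $2\pi i\mathbb Z$. It
  -- is removed by a term linear in $q_n$ on one edge at $n$, which leaves the equations at all
  -- other sites unchanged.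
  refine ⟨fun n k => if k = 0 then fun z => ψ n k z - variationalDerivative ψ q₀ n * z.1
    else ψ n k, fun n k => ?_, fun n => ?_⟩
  · by_cases hk : k = 0
    · simp only [hk, if_true]
      exact (hψ n 0).sub_linear (hc n)
    · simp only [hk, if_false]
      exact hψ n k
  · have h3 : DifferentiableAt ℂ (fun t => ψ n 0 (t, q₀ (n - dir 0))) (q₀ n) :=
      DifferentiableAt.comp (f := fun t => (t, q₀ (n - dir 0))) (q₀ n)
        (hψ n 0).1.differentiableAt (by fun_prop)
    have h4 := ((h3.hasDerivAt).fun_sub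
      ((hasDerivAt_id' (q₀ n)).const_mul (variationalDerivative ψ q₀ n))).deriv
    simp only [mul_one] at h4
    have h5 : variationalDerivative ψ q₀ n = variationalDerivative ψ q₀ n := rfl
    conv_rhs at h5 => rw [variationalDerivative, Fin.sum_univ_three]
    rw [variationalDerivative, Fin.sum_univ_three]
    simp only [if_true, one_ne_zero, if_false, deriv_sub_const, Fin.reduceEq]
    erw [h4]
    linear_combination -h5

end

/-! ### The extension of the flows off the solutions, and local functions. -/

section

variable {s : ℂ → ℂ} {a : Fin 3 → ℂ} {q q₀ : Field} {n : ℤ × ℤ} {i j k : Fin 3}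

/-- The field with prescribed values `u` on the translate by `n` of `S`, and those of `q₀`
elsewhere. -/
def extend (S : Finset (ℤ × ℤ)) (q₀ : Field) (n : ℤ × ℤ) (u : S → ℂ) : Field :=
  fun m => if h : m - n ∈ S then u ⟨m - n, h⟩ else q₀ m

theorem extend_window (S : Finset (ℤ × ℤ)) (q₀ : Field) (n : ℤ × ℤ) :
    extend S q₀ n (window S n q₀) = q₀ := by
  funext m
  simp [extend, window]

theorem window_extend (S : Finset (ℤ × ℤ)) (q₀ : Field) (n : ℤ × ℤ) (u : S → ℂ) :
    window S n (extend S q₀ n u) = u := by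
  funext m
  simp [extend, window]

theorem analyticAt_extend (S : Finset (ℤ × ℤ)) (q₀ : Field) (n m : ℤ × ℤ) (u : S → ℂ) :
    AnalyticAt ℂ (fun u => extend S q₀ n u m) u := by
  by_cases h : m - n ∈ S
  · simp only [extend, h, dif_pos]
    exact (ContinuousLinearMap.proj (R := ℂ) (φ := fun _ : S => ℂ) ⟨m - n, h⟩).analyticAt u
  · simp only [extend, h, dif_neg, not_false_eq_true]
    exact analyticAt_const

theorem continuous_window (S : Finset (ℤ × ℤ)) (n : ℤ × ℤ) : Continuous (window S n) := by
  unfold window; fun_prop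

section Analytic

variable {E : Type*} [NormedAddCommGroup E] [NormedSpace ℂ E] {x y : E → ℂ} {e : E}

theorem analyticAt_bracket (hs : IsSigmaLike s) (hx : AnalyticAt ℂ x e) (hy : AnalyticAt ℂ y e) :
    AnalyticAt ℂ (fun e => bracket s (x e) (y e)) e :=
  ((hs.analyticAt _).fun_comp (hx.add hy)).mul ((hs.analyticAt _).fun_comp (hx.sub hy))

theorem analyticAt_factor (hs : IsSigmaLike s) {α : ℂ} (hx : AnalyticAt ℂ x e)
    (hy : AnalyticAt ℂ y e) (h : EdgeRegular s α (x e) (y e)) :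
    AnalyticAt ℂ (fun e => factor s (x e) (y e) α) e := by
  simp only [factor_eq_bracket, sub_eq_add_neg]
  exact (analyticAt_bracket hs (hx.add analyticAt_const) hy).div
    (analyticAt_bracket hs (hx.add analyticAt_const) hy) h.neg.bracket_ne_zero

variable {X : E → Field}

theorem analyticAt_flowProd (hX : ∀ m, AnalyticAt ℂ (fun e => X e m) e)
    (hs : IsSigmaLike s) (h : IsRegularAt s a (X e) n) (i : Fin 3) :
    AnalyticAt ℂ (fun e => flowProd s a i (X e) n) e := by
  obtain ⟨j, k, ht⟩ := exists_isTriple i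
  simp only [flowProd_eq ht]
  exact ((analyticAt_factor hs (hX _) (hX _) (h.add i)).mul
    (analyticAt_factor hs (hX _) (hX _) (h.sub j))).mul
    (analyticAt_factor hs (hX _) (hX _) (h.sub k))

theorem analyticAt_eqProd (hX : ∀ m, AnalyticAt ℂ (fun e => X e m) e)
    (hs : IsSigmaLike s) (h : IsRegularAt s a (X e) n) :
    AnalyticAt ℂ (fun e => eqProd s a (X e) n) e := by
  obtain ⟨j, k, ht⟩ := exists_isTriple 0
  simp only [eqProd_eq ht]
  exact (((analyticAt_factor hs (hX _) (hX _) (h.add 0)).mul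
    (analyticAt_factor hs (hX _) (hX _) (h.sub j))).mul
    (analyticAt_factor hs (hX _) (hX _) (h.sub k))).mul
    (((analyticAt_factor hs (hX _) (hX _) (h.sub 0)).mul
    (analyticAt_factor hs (hX _) (hX _) (h.add j))).mul
    (analyticAt_factor hs (hX _) (hX _) (h.add k)))

theorem analyticAt_legDiff (hX : ∀ m, AnalyticAt ℂ (fun e => X e m) e)
    (hs : IsSigmaLike s) (α β γ : ℂ) (m₀ m₁ m₂ m₃ : ℤ × ℤ) :
    AnalyticAt ℂ (fun e => legDiff s α β γ (X e m₀) (X e m₁) (X e m₂) (X e m₃)) e := by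
  have P (α β γ : ℂ) := ((analyticAt_bracket hs ((hX m₀).add (analyticAt_const (v := α)))
    (hX m₁)).mul (analyticAt_bracket hs ((hX m₀).add (analyticAt_const (v := β))) (hX m₂))).mul
    (analyticAt_bracket hs ((hX m₀).add (analyticAt_const (v := γ))) (hX m₃))
  exact (P α β γ).sub (P (-α) (-β) (-γ))

end Analytic

/-- The analytic function `log w / (w - 1)` near `w = 1`. -/
def logSlope : ℂ → ℂ := dslope Complex.log 1

theorem log_eq_logSlope (w : ℂ) : Complex.log w = logSlope w * (w - 1) := by
  have := sub_smul_dslope Complex.log 1 w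
  rw [Complex.log_one, sub_zero, smul_eq_mul] at this
  rw [← this, mul_comm, logSlope]

theorem logSlope_one : logSlope 1 = 1 := by
  rw [logSlope, dslope_same, (Complex.hasDerivAt_log (by simp)).deriv, inv_one]

theorem analyticAt_logSlope : AnalyticAt ℂ logSlope 1 := by
  obtain ⟨p, hp⟩ := analyticAt_clog (z := 1) (by simp)
  exact ⟨_, hp.has_fpower_series_dslope_fslope⟩

/-- The extension off the solutions of the velocity of a flow: the quotient of
`log Q - 2 log ((P - Q) / (P - 1))` and `log Q`, where `P = flowProd` and `Q = eqProd`. -/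
def extVelocity (s : ℂ → ℂ) (a : Fin 3 → ℂ) (i : Fin 3) (q : Field) (n : ℤ × ℤ) : ℂ :=
  1 + 2 / (flowProd s a i q n - 1) *
    (logSlope (1 - (eqProd s a q n - 1) / (flowProd s a i q n - 1)) / logSlope (eqProd s a q n))

theorem extVelocity_eq (h : IsFlowPoint s a i q n) :
    extVelocity s a i q n = velocity s a i q n := by
  have h1 : flowProd s a i q n - 1 ≠ 0 := sub_ne_zero.mpr h.2
  -- At $Q=1$ both values of `logSlope` are $1$, leaving $1+2/(P-1)=(P+1)/(P-1)$.
  rw [extVelocity, velocity, h.1.2, sub_self, zero_div, sub_zero, logSlope_one]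
  field_simp
  ring

theorem analyticAt_extVelocity {E : Type*} [NormedAddCommGroup E] [NormedSpace ℂ E]
    {X : E → Field} {e : E} (hX : ∀ m, AnalyticAt ℂ (fun e => X e m) e) (hs : IsSigmaLike s)
    (h : IsFlowPoint s a i (X e) n) : AnalyticAt ℂ (fun e => extVelocity s a i (X e) n) e := by
  have h1 : flowProd s a i (X e) n - 1 ≠ 0 := sub_ne_zero.mpr h.2
  have hP := (analyticAt_flowProd hX hs h.1.1 i).sub (analyticAt_const (v := (1 : ℂ)))
  have hQ := analyticAt_eqProd hX hs h.1.1
  have hv := analyticAt_const (v := (1 : ℂ)).sub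
    ((hQ.sub (analyticAt_const (v := (1 : ℂ)))).div hP h1)
  refine analyticAt_const.add ((analyticAt_const.div hP h1).mul
    (AnalyticAt.div (AnalyticAt.fun_comp ?_ hv) (AnalyticAt.fun_comp ?_ hQ) ?_))
  · simpa [h.1.2] using analyticAt_logSlope
  · simpa [h.1.2] using analyticAt_logSlope
  · simp [h.1.2, logSlope_one]

/-- The characteristic of the extended flow, a function of the values at a site and its
neighbours. -/
def characteristic (s : ℂ → ℂ) (a : Fin 3 → ℂ) (i : Fin 3) (u : star → ℂ) : ℂ :=
  extVelocity s a i (extend star 0 0 u) 0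

theorem extVelocity_congr {q q' : Field} {n n' : ℤ × ℤ}
    (h : ∀ m ∈ star, q (n + m) = q' (n' + m)) :
    extVelocity s a i q n = extVelocity s a i q' n' := by
  have h0 : q n = q' n' := by
    have := h 0 (by decide)
    rwa [add_zero, add_zero] at this
  have h1 : flowProd s a i q n = flowProd s a i q' n' := by
    fin_cases i <;> simp only [flowProd, h0, h (1, 0) (by decide), h (-1, 0) (by decide),
      h (0, 1) (by decide), h (0, -1) (by decide), h (1, 1) (by decide), h (-1, -1) (by decide)]
  have h2 : eqProd s a q n = eqProd s a q' n' := by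
    simp only [eqProd, h0, h (1, 0) (by decide), h (-1, 0) (by decide),
      h (0, 1) (by decide), h (0, -1) (by decide), h (1, 1) (by decide), h (-1, -1) (by decide)]
  rw [extVelocity, extVelocity, h1, h2]

theorem characteristic_window (s : ℂ → ℂ) (a : Fin 3 → ℂ) (i : Fin 3) (q : Field) (n : ℤ × ℤ) :
    characteristic s a i (window star n q) = extVelocity s a i q n :=
  extVelocity_congr fun m hm => by simp [extend, window, hm]

theorem analyticAt_characteristic (hs : IsSigmaLike s) (h : IsFlowPoint s a i q n) :
    AnalyticAt ℂ (characteristic s a i) (window star n q) := by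
  have e : characteristic s a i = fun u => extVelocity s a i (extend star q n u) n := by
    funext u
    rw [← characteristic_window, window_extend]
  rw [e]
  exact analyticAt_extVelocity (analyticAt_extend star q n · _) hs (by rwa [extend_window])

/-- `g` is near `q₀` an analytic function of the values of the field at distance at most `r` from
the site `n`. -/
structure IsLocal (q₀ : Field) (r : ℤ) (n : ℤ × ℤ) (g : Field → ℂ) : Prop where
  analyticAt : ∀ (S : Finset (ℤ × ℤ)) (m : ℤ × ℤ),
    AnalyticAt ℂ (fun u => g (extend S q₀ m u)) (window S m q₀)
  congr : ∀ q q' : Field, (∀ m : ℤ × ℤ, |m.1 - n.1| ≤ r → |m.2 - n.2| ≤ r → q m = q' m) →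
    g q = g q'

namespace IsLocal

variable {r : ℤ} {g g' : Field → ℂ}

theorem add (h : IsLocal q₀ r n g) (h' : IsLocal q₀ r n g') :
    IsLocal q₀ r n fun q => g q + g' q :=
  ⟨fun S m => (h.analyticAt S m).add (h'.analyticAt S m), fun q q' H => by
    rw [h.congr q q' H, h'.congr q q' H]⟩

theorem sub (h : IsLocal q₀ r n g) (h' : IsLocal q₀ r n g') :
    IsLocal q₀ r n fun q => g q - g' q :=
  ⟨fun S m => (h.analyticAt S m).sub (h'.analyticAt S m), fun q q' H => by
    rw [h.congr q q' H, h'.congr q q' H]⟩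

theorem mul (h : IsLocal q₀ r n g) (h' : IsLocal q₀ r n g') :
    IsLocal q₀ r n fun q => g q * g' q :=
  ⟨fun S m => (h.analyticAt S m).mul (h'.analyticAt S m), fun q q' H => by
    rw [h.congr q q' H, h'.congr q q' H]⟩

theorem const (c : ℂ) : IsLocal q₀ r n fun _ => c :=
  ⟨fun _ _ => analyticAt_const, fun _ _ _ => rfl⟩

theorem log_div (h : IsLocal q₀ r n g) (h0 : g q₀ ≠ 0) :
    IsLocal q₀ r n fun q => Complex.log (g q / g q₀) :=
  ⟨fun S m => ((h.analyticAt S m).div_const).clog (by simp [extend_window, div_self h0]),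
    fun q q' H => by rw [h.congr q q' H]⟩

theorem shift {n' : ℤ × ℤ} {r' : ℤ} (h : IsLocal q₀ r n g) (h1 : |n.1 - n'.1| ≤ r' - r)
    (h2 : |n.2 - n'.2| ≤ r' - r) : IsLocal q₀ r' n' g :=
  ⟨h.analyticAt, fun q q' H => h.congr q q' fun m hm1 hm2 => H m
    (by rw [abs_le] at *; constructor <;> linarith [hm1.1, hm1.2, h1.1, h1.2])
    (by rw [abs_le] at *; constructor <;> linarith [hm2.1, hm2.2, h2.1, h2.2])⟩

theorem apply_extend_window (h : IsLocal q₀ r n g) (q : Field) :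
    g (extend (Finset.Icc (-r, -r) (r, r)) q₀ n
      (window (Finset.Icc (-r, -r) (r, r)) n q)) = g q := by
  refine h.congr _ _ fun m h1 h2 => ?_
  rw [abs_le] at h1 h2
  have : m - n ∈ Finset.Icc (-r, -r) (r, r) := by
    simp only [Finset.mem_Icc, Prod.le_def, Prod.fst_sub, Prod.snd_sub]
    exact ⟨⟨h1.1, h2.1⟩, h1.2, h2.2⟩
  simp only [extend, window, this, dif_pos, add_sub_cancel]

/-- A local function factors through a finite window, so its analyticity in finitely many variables
gives continuity for the product topology on fields. -/
theorem continuousAt (h : IsLocal q₀ r n g) : ContinuousAt g q₀ := by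
  rw [show g = (fun u => g (extend (Finset.Icc (-r, -r) (r, r)) q₀ n u)) ∘
    window (Finset.Icc (-r, -r) (r, r)) n from funext fun q => (h.apply_extend_window q).symm]
  exact (h.analyticAt _ n).continuousAt.comp (continuous_window _ n).continuousAt

end IsLocal

theorem abs_dir_le (m : Fin 3) : |(dir m).1| ≤ 1 ∧ |(dir m).2| ≤ 1 := by
  revert m; decide

end

/-! ### The multiplicative conservation law and its logarithm. -/

section

variable {s : ℂ → ℂ} {a : Fin 3 → ℂ} {q q₀ : Field} {n : ℤ × ℤ} {i j k : Fin 3}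

/-- The three-leg polynomial on the rhombus with short diagonal from `n` to `n + dir i`. -/
def rhombus (s : ℂ → ℂ) (a : Fin 3 → ℂ) (i j k : Fin 3) (n : ℤ × ℤ) (q : Field) : ℂ :=
  legDiff s (a i) (a j) (a k) (q n) (q (n + dir i)) (q (n - dir j)) (q (n - dir k)) / s (2 * q n)

/-- The product of the numerator and the denominator of the factor on the edge from `n` to
`n + dir m`. -/
def edgeProd (s : ℂ → ℂ) (a : Fin 3 → ℂ) (m : Fin 3) (n : ℤ × ℤ) (q : Field) : ℂ :=
  bracket s (q n + a m) (q (n + dir m)) * bracket s (q n - a m) (q (n + dir m))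

/-- By the three-leg identity the rhombus function behind $n$ can be written with its legs at $n$.
Both rhombus functions adjacent to $n$ then have the same denominator $s(2q_n)$. -/
theorem rhombus_sub (hs : IsSigmaLike s) (ha : a 0 + a 1 + a 2 = 0) (ht : IsTriple i j k)
    (h : s (2 * q n) ≠ 0) (h' : s (2 * q (n - dir i)) ≠ 0) :
    rhombus s a i j k (n - dir i) q =
      legDiff s (a i) (a j) (a k) (q n) (q (n - dir i)) (q (n + dir j)) (q (n + dir k)) /
        s (2 * q n) := by
  rw [rhombus, sub_add_cancel, ht.sub_dir, ht.swap.sub_dir, div_eq_div_iff h' h, mul_comm,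
    hs.legDiff_symm (ht.param_add ha), mul_comm, legDiff_swap]

theorem edgeProd_sub (hs : IsSigmaLike s) (m : Fin 3) : edgeProd s a m (n - dir m) q =
    bracket s (q n + a m) (q (n - dir m)) * bracket s (q n - a m) (q (n - dir m)) := by
  rw [edgeProd, sub_add_cancel]
  generalize q (n - dir m) = p
  simp only [bracket]
  rw [show p + a m - q n = -(q n - a m - p) by ring, show p - a m - q n = -(q n + a m - p) by ring,
    hs.odd, hs.odd]
  ring_nf

/-- With $P=N/D$ and $Q=(N/D)(M/E)$ one has $(P-Q)/(P-1)=N(M-E)/(E(D-N))$. Squaring leaves only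
differences and products of numerators and denominators, which are what rhombi and edges carry. -/
theorem div_sq_eq {N D M E : ℂ} (hN : N ≠ 0) (hD : D ≠ 0) (hM : M ≠ 0) (hE : E ≠ 0)
    (h : N - D ≠ 0) (h' : M - E ≠ 0) :
    N / D * (M / E) / (1 - (N / D * (M / E) - 1) / (N / D - 1)) ^ 2 =
      ((N - D) / (M - E)) ^ 2 * (M * E / (N * D)) := by
  have e : N / D - 1 = (N - D) / D := by field_simp
  have e2 : 1 - (N / D * (M / E) - 1) / (N / D - 1) = N * (M - E) / (E * (D - N)) := by
    have h2 : D - N ≠ 0 := fun h3 => h (by linear_combination -h3)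
    rw [e]
    field_simp
    ring
  rw [e2]
  have h2 : D - N ≠ 0 := fun h3 => h (by linear_combination -h3)
  field_simp
  ring

theorem eqProd_div_sq (hs : IsSigmaLike s) (ha : a 0 + a 1 + a 2 = 0) (ht : IsTriple i j k)
    (h0 : rhombus s a i j k n q ≠ 0) (h1 : rhombus s a i j k (n - dir i) q ≠ 0)
    (he : ∀ m, edgeProd s a m n q ≠ 0) (he' : ∀ m, edgeProd s a m (n - dir m) q ≠ 0) :
    eqProd s a q n / (1 - (eqProd s a q n - 1) / (flowProd s a i q n - 1)) ^ 2 =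
      (rhombus s a i j k n q / rhombus s a i j k (n - dir i) q) ^ 2 *
        (edgeProd s a i (n - dir i) q / edgeProd s a i n q) *
        (edgeProd s a j n q / edgeProd s a j (n - dir j) q) *
        (edgeProd s a k n q / edgeProd s a k (n - dir k) q) := by
  have z0 : s (2 * q n) ≠ 0 := (div_ne_zero_iff.mp h0).2
  have z1 : s (2 * q (n - dir i)) ≠ 0 := (div_ne_zero_iff.mp h1).2
  have l0 := (div_ne_zero_iff.mp h0).1
  rw [rhombus_sub hs ha ht z0 z1] at h1 ⊢
  have l1 := (div_ne_zero_iff.mp h1).1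
  simp only [edgeProd_sub hs] at he' ⊢
  rw [eqProd_eq ht, flowProd_eq ht, factor_mul, factor_mul]
  have a1 := mul_ne_zero_iff.mp (he i)
  have a2 := mul_ne_zero_iff.mp (he j)
  have a3 := mul_ne_zero_iff.mp (he k)
  have b1 := mul_ne_zero_iff.mp (he' i)
  have b2 := mul_ne_zero_iff.mp (he' j)
  have b3 := mul_ne_zero_iff.mp (he' k)
  simp only [legDiff] at l0 l1
  rw [div_sq_eq _ _ _ _ l0 l1]
  · rw [rhombus, div_div_div_cancel_right₀ z0]
    simp only [edgeProd, legDiff, legProd, ← sub_eq_add_neg]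
    obtain ⟨a11, a12⟩ := a1
    obtain ⟨a21, a22⟩ := a2
    obtain ⟨a31, a32⟩ := a3
    obtain ⟨b11, b12⟩ := b1
    obtain ⟨b21, b22⟩ := b2
    obtain ⟨b31, b32⟩ := b3
    simp only [mul_assoc]
    congr 1
    field_simp
  all_goals simp only [legProd, ← sub_eq_add_neg]
  · exact mul_ne_zero (mul_ne_zero a1.1 b2.1) b3.1
  · exact mul_ne_zero (mul_ne_zero a1.2 b2.2) b3.2
  · exact mul_ne_zero (mul_ne_zero b1.1 a2.1) a3.1
  · exact mul_ne_zero (mul_ne_zero b1.2 a2.2) a3.2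

theorem IsFlowPoint.edgeProd_ne_zero (h : IsFlowPoint s a i q n) (m : Fin 3) :
    edgeProd s a m n q ≠ 0 :=
  mul_ne_zero (h.1.1.add m).bracket_ne_zero
    (by simpa [← sub_eq_add_neg] using (h.1.1.add m).neg.bracket_ne_zero)

theorem IsFlowPoint.rhombus_ne_zero (hs : IsSigmaLike s) (ha : a 0 + a 1 + a 2 = 0)
    (ht : IsTriple i j k) (h : IsFlowPoint s a i q n) : rhombus s a i j k n q ≠ 0 :=
  div_ne_zero (h.legDiff_fst ht) (sigma_two_mul_ne_zero hs ha ht h)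

theorem near_add_dir (n : ℤ × ℤ) (m : Fin 3) :
    |(n + dir m).1 - n.1| ≤ 1 ∧ |(n + dir m).2 - n.2| ≤ 1 := by
  simpa using abs_dir_le m

theorem near_sub_dir (n : ℤ × ℤ) (m : Fin 3) :
    |(n - dir m).1 - n.1| ≤ 1 ∧ |(n - dir m).2 - n.2| ≤ 1 := by
  simpa [abs_neg] using abs_dir_le m

theorem isLocal_edgeProd (hs : IsSigmaLike s) (q₀ : Field) (m : Fin 3) (n : ℤ × ℤ) :
    IsLocal q₀ 1 n (edgeProd s a m n) := by
  refine ⟨fun S p => ?_, fun q q' h => ?_⟩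
  · have e (r) := analyticAt_extend S q₀ p r (window S p q₀)
    exact (analyticAt_bracket hs ((e n).add analyticAt_const) (e (n + dir m))).mul
      (analyticAt_bracket hs ((e n).sub analyticAt_const) (e (n + dir m)))
  · have h0 := h n (by simp) (by simp)
    have h1 := h (n + dir m) (near_add_dir n m).1 (near_add_dir n m).2
    simp only [edgeProd, h0, h1]

theorem isLocal_rhombus (hs : IsSigmaLike s) (h0 : rhombus s a i j k n q₀ ≠ 0) :
    IsLocal q₀ 1 n (rhombus s a i j k n) := by
  refine ⟨fun S p => ?_, fun q q' h => ?_⟩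
  · have e (r) := analyticAt_extend S q₀ p r (window S p q₀)
    refine (analyticAt_legDiff e hs _ _ _ _ _ _ _).div
      ((hs.analyticAt _).fun_comp (analyticAt_const.mul (e n))) ?_
    rw [extend_window]
    exact (div_ne_zero_iff.mp h0).2
  · have h0 := h n (by simp) (by simp)
    have h1 := h (n + dir i) (near_add_dir n i).1 (near_add_dir n i).2
    have h2 := h (n - dir j) (near_sub_dir n j).1 (near_sub_dir n j).2
    have h3 := h (n - dir k) (near_sub_dir n k).1 (near_sub_dir n k).2
    simp only [rhombus, h0, h1, h2, h3]

theorem isLocal_extVelocity (hs : IsSigmaLike s) (h : IsFlowPoint s a i q₀ n) :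
    IsLocal q₀ 1 n fun q => extVelocity s a i q n := by
  refine ⟨fun S p => ?_, fun q q' h => ?_⟩
  · exact analyticAt_extVelocity (analyticAt_extend S q₀ p · _) hs (by rwa [extend_window])
  · refine extVelocity_congr fun m hm => ?_
    have : ∀ m ∈ star, |m.1| ≤ 1 ∧ |m.2| ≤ 1 := by decide
    exact h (n + m) (by simpa using (this m hm).1) (by simpa using (this m hm).2)

theorem hasDerivAt_partial {φ : ℂ × ℂ → ℂ} {z₀ : ℂ × ℂ} (h : AnalyticAt ℂ φ z₀) :
    ∀ᶠ z in 𝓝 z₀, HasDerivAt (fun t => φ (t, z.2)) (fderiv ℂ φ z (1, 0)) z.1 ∧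
      HasDerivAt (fun t => φ (z.1, t)) (fderiv ℂ φ z (0, 1)) z.2 := by
  filter_upwards [h.eventually_analyticAt] with z hz
  have hd := hz.differentiableAt.hasFDerivAt
  exact ⟨HasFDerivAt.comp_hasDerivAt (f := fun t => (t, z.2)) z.1 hd
      ((hasDerivAt_id z.1).prodMk (hasDerivAt_const _ _)),
    HasFDerivAt.comp_hasDerivAt (f := fun t => (z.1, t)) z.2 hd
      ((hasDerivAt_const _ _).prodMk (hasDerivAt_id z.2))⟩

/-- The derivatives of the edge function on the edge from `m` to `m'`. -/
def edgeDeriv (φ : ℂ × ℂ → ℂ) (m m' : ℤ × ℤ) (d : ℂ × ℂ) (q : Field) : ℂ :=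
  fderiv ℂ φ (q m, q m') d

theorem isLocal_edgeDeriv {φ : ℂ × ℂ → ℂ} {m m' : ℤ × ℤ} (d : ℂ × ℂ)
    (h : AnalyticAt ℂ φ (q₀ m, q₀ m')) (h1 : |m.1 - n.1| ≤ 1 ∧ |m.2 - n.2| ≤ 1)
    (h2 : |m'.1 - n.1| ≤ 1 ∧ |m'.2 - n.2| ≤ 1) : IsLocal q₀ 1 n (edgeDeriv φ m m' d) := by
  refine ⟨fun S p => ?_, fun q q' H => ?_⟩
  · have e (r) := analyticAt_extend S q₀ p r (window S p q₀)
    have hf : AnalyticAt ℂ (fun z => fderiv ℂ φ z d) (q₀ m, q₀ m') :=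
      ((ContinuousLinearMap.apply ℂ ℂ d).analyticAt _).fun_comp h.fderiv
    refine AnalyticAt.fun_comp (g := fun z => fderiv ℂ φ z d) ?_ ((e m).prod (e m'))
    rwa [extend_window]
  · simp only [edgeDeriv, H m h1.1 h1.2, H m' h2.1 h2.2]

theorem variationalDerivative_eq {φ : ℤ × ℤ → Fin 3 → ℂ × ℂ → ℂ}
    (h : ∀ n k, AnalyticAt ℂ (φ n k) (q₀ n, q₀ (n - dir k))) (n : ℤ × ℤ) :
    ∀ᶠ q in 𝓝 q₀, variationalDerivative φ q n =
      ∑ m, (edgeDeriv (φ n m) n (n - dir m) (1, 0) q +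
        edgeDeriv (φ (n + dir m) m) (n + dir m) n (0, 1) q) := by
  have c (m m' : ℤ × ℤ) : ContinuousAt (fun q : Field => (q m, q m')) q₀ := by fun_prop
  have e (k : Fin 3) := (c n (n - dir k)).eventually (hasDerivAt_partial (h n k))
  have e' (k : Fin 3) : ∀ᶠ q in 𝓝 q₀, HasDerivAt (fun t => φ (n + dir k) k (q (n + dir k), t))
      (edgeDeriv (φ (n + dir k) k) (n + dir k) n (0, 1) q) (q n) := by
    have h1 := hasDerivAt_partial (h (n + dir k) k)
    rw [add_sub_cancel_right] at h1
    exact ((c (n + dir k) n).eventually h1).mono fun q hq => hq.2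
  filter_upwards [eventually_all.mpr e, eventually_all.mpr e'] with q h1 h2
  refine Finset.sum_congr rfl fun m _ => ?_
  rw [(h1 m).1.deriv, (h2 m).deriv]
  rfl

theorem continuousAt_variationalDerivative {φ : ℤ × ℤ → Fin 3 → ℂ × ℂ → ℂ}
    (h : ∀ n k, AnalyticAt ℂ (φ n k) (q₀ n, q₀ (n - dir k))) (n : ℤ × ℤ) :
    ContinuousAt (fun q => variationalDerivative φ q n) q₀ := by
  have e : IsLocal q₀ 1 n fun q => ∑ m, (edgeDeriv (φ n m) n (n - dir m) (1, 0) q +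
        edgeDeriv (φ (n + dir m) m) (n + dir m) n (0, 1) q) := by
    have e1 (m : Fin 3) := (isLocal_edgeDeriv (n := n) (1, 0) (h n m) (by simp)
      (near_sub_dir n m)).add (isLocal_edgeDeriv (n := n) (m' := n) (0, 1)
        (by simpa using h (n + dir m) m) (near_add_dir n m) (by simp))
    simp only [Fin.sum_univ_three]
    exact ((e1 0).add (e1 1)).add (e1 2)
  exact e.continuousAt.congr ((variationalDerivative_eq h n).mono fun q hq => hq.symm)

/-- The difference lies in $2\pi i\mathbb Z$, vanishes at $x$ and is continuous, so near $x$ its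
imaginary part stays below $\pi$ in modulus. -/
theorem eventually_eq_of_exp_eq {X : Type*} [TopologicalSpace X] {f g : X → ℂ} {x : X}
    (hf : ContinuousAt f x) (hg : ContinuousAt g x) (h0 : f x = g x)
    (h : ∀ᶠ y in 𝓝 x, Complex.exp (f y) = Complex.exp (g y)) : ∀ᶠ y in 𝓝 x, f y = g y := by
  have hc : ContinuousAt (fun y => (f y - g y).im) x :=
    Complex.continuous_im.continuousAt.comp (hf.sub hg)
  have hm : Set.Ioo (-Real.pi) Real.pi ∈ 𝓝 ((f x - g x).im) := by
    rw [h0, sub_self]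
    exact Ioo_mem_nhds (by simpa using Real.pi_pos) (by simpa using Real.pi_pos)
  filter_upwards [h, hc.eventually hm] with y h1 h2
  have h3 := Complex.log_exp h2.1 h2.2.le
  rw [Complex.exp_sub, h1, div_self (Complex.exp_ne_zero _), Complex.log_one] at h3
  exact sub_eq_zero.mp h3.symm

/-- The flux in the direction `m` of the derivative of the action along the `i`-th flow, up to the
boundary terms of the summation by parts. -/
def logFlux (s : ℂ → ℂ) (a : Fin 3 → ℂ) (i j k : Fin 3) (q₀ : Field) (m : Fin 3) (n : ℤ × ℤ)
    (q : Field) : ℂ :=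
  if m = i then 2 * Complex.log (rhombus s a i j k n q / rhombus s a i j k n q₀) -
    Complex.log (edgeProd s a m n q / edgeProd s a m n q₀)
  else Complex.log (edgeProd s a m n q / edgeProd s a m n q₀)

theorem isLocal_logFlux (hs : IsSigmaLike s) (ha : a 0 + a 1 + a 2 = 0) (ht : IsTriple i j k)
    (h : IsFlowPoint s a i q₀ n) (m : Fin 3) : IsLocal q₀ 1 n (logFlux s a i j k q₀ m n) := by
  have h1 := (isLocal_edgeProd (a := a) hs q₀ m n).log_div (h.edgeProd_ne_zero m)
  have h2 := (isLocal_rhombus hs (h.rhombus_ne_zero hs ha ht)).log_div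
    (h.rhombus_ne_zero hs ha ht)
  unfold logFlux
  by_cases hm : m = i
  · simp only [hm, if_true] at h1 ⊢
    exact ((IsLocal.const 2).mul h2).sub h1
  · simp only [hm, if_false]
    exact h1

theorem logFlux_self (s : ℂ → ℂ) (a : Fin 3 → ℂ) (i j k : Fin 3) (q₀ : Field) (m : Fin 3)
    (n : ℤ × ℤ) : logFlux s a i j k q₀ m n q₀ = 0 := by
  have h (z : ℂ) : Complex.log (z / z) = 0 := by
    by_cases hz : z = 0 <;> simp [hz]
  simp [logFlux, h]

theorem extVelocity_mul_log (h : flowProd s a i q n - 1 ≠ 0) (h' : logSlope (eqProd s a q n) ≠ 0) :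
    extVelocity s a i q n * Complex.log (eqProd s a q n) = Complex.log (eqProd s a q n) -
      2 * Complex.log (1 - (eqProd s a q n - 1) / (flowProd s a i q n - 1)) := by
  rw [extVelocity, log_eq_logSlope, log_eq_logSlope]
  field_simp
  ring

/-- The product of the extended velocity and the variational derivative of the action is the
divergence of `logFlux`. -/
theorem extVelocity_mul_variationalDerivative (hs : IsSigmaLike s) (ha : a 0 + a 1 + a 2 = 0)
    (ht : IsTriple i j k) {φ : ℤ × ℤ → Fin 3 → ℂ × ℂ → ℂ} (h : ∀ n, IsFlowPoint s a i q₀ n)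
    (hφ : IsActionBranch s a q₀ φ) (n : ℤ × ℤ) :
    ∀ᶠ q in 𝓝 q₀, extVelocity s a i q n * variationalDerivative φ q n =
      ∑ m, (logFlux s a i j k q₀ m n q - logFlux s a i j k q₀ m (n - dir m) q) := by
  have hv := continuousAt_variationalDerivative (fun n k => (hφ.1 n k).1) n
  have hexp := exp_variationalDerivative (fun n k => hφ.1 n k) n
  have hQ : ContinuousAt (fun q => eqProd s a q n) q₀ :=
    (Complex.continuous_exp.continuousAt.comp hv).congr hexp
  have hQ0 : eqProd s a q₀ n = 1 := (h n).1.2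
  have hlog : ∀ᶠ q in 𝓝 q₀, variationalDerivative φ q n = Complex.log (eqProd s a q n) := by
    refine eventually_eq_of_exp_eq hv (hQ.clog (by simp [hQ0])) (by simp [hφ.2 n, hQ0]) ?_
    filter_upwards [hexp, hQ.eventually_ne (by simp [hQ0] : eqProd s a q₀ n ≠ 0)] with q h1 h2
    rw [Complex.exp_log h2, h1]
  have hr := (isLocal_rhombus hs ((h n).rhombus_ne_zero hs ha ht)).continuousAt.eventually_ne
    ((h n).rhombus_ne_zero hs ha ht)
  have hr' := (isLocal_rhombus hs
    ((h (n - dir i)).rhombus_ne_zero hs ha ht)).continuousAt.eventually_ne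
    ((h (n - dir i)).rhombus_ne_zero hs ha ht)
  have he := eventually_all.mpr fun m => (isLocal_edgeProd hs q₀ m n).continuousAt.eventually_ne
    ((h n).edgeProd_ne_zero m)
  have he' := eventually_all.mpr fun m => (isLocal_edgeProd hs q₀ m
    (n - dir m)).continuousAt.eventually_ne ((h (n - dir m)).edgeProd_ne_zero m)
  have hPl : IsLocal q₀ 1 n fun q => flowProd s a i q n := by
    refine ⟨fun S p => analyticAt_flowProd (analyticAt_extend S q₀ p · _) hs
      (by rw [extend_window]; exact (h n).1.1) i, fun q q' h => ?_⟩
    have h0 := h n (by simp) (by simp)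
    have h1 (m : Fin 3) := h (n + dir m) (near_add_dir n m).1 (near_add_dir n m).2
    have h2 (m : Fin 3) := h (n - dir m) (near_sub_dir n m).1 (near_sub_dir n m).2
    simp only [flowProd_eq ht, h0, h1, h2]
  have hP1 : flowProd s a i q₀ n - 1 ≠ 0 := sub_ne_zero.mpr (h n).2
  have hP := hPl.continuousAt.sub (continuousAt_const (y := (1 : ℂ)))
  have hw : ContinuousAt (fun q => 1 - (eqProd s a q n - 1) / (flowProd s a i q n - 1)) q₀ :=
    continuousAt_const.sub ((hQ.sub continuousAt_const).div hP hP1)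
  have hw0 : 1 - (eqProd s a q₀ n - 1) / (flowProd s a i q₀ n - 1) = 1 := by simp [hQ0]
  have hsl : ContinuousAt (fun q => logSlope (eqProd s a q n)) q₀ :=
    ContinuousAt.comp (f := fun q => eqProd s a q n) (g := logSlope)
      (by rw [hQ0]; exact analyticAt_logSlope.continuousAt) hQ
  -- The logarithm of `eqProd_div_sq`. All logarithms are normalised by the values at $q_0$, so both
  -- sides vanish there and comparing exponentials suffices. This comparison divides the identity at
  -- $q$ by the one at $q_0$, where the left-hand side is $1$.
  have key : ∀ᶠ q in 𝓝 q₀, Complex.log (eqProd s a q n) -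
      2 * Complex.log (1 - (eqProd s a q n - 1) / (flowProd s a i q n - 1)) =
      ∑ m, (logFlux s a i j k q₀ m n q - logFlux s a i j k q₀ m (n - dir m) q) := by
    refine eventually_eq_of_exp_eq
      ((hQ.clog (by simp [hQ0])).sub (continuousAt_const.mul (hw.clog (by simp [hQ0])))) ?_
      (by simp [hQ0, logFlux_self]) ?_
    · simp only [Fin.sum_univ_three]
      have c (m : Fin 3) := (isLocal_logFlux hs ha ht (h n) m).continuousAt.sub
        (isLocal_logFlux hs ha ht (h (n - dir m)) m).continuousAt
      exact ((c 0).add (c 1)).add (c 2)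
    · filter_upwards [hr, hr', he, he', hQ.eventually_ne (by simp [hQ0] : eqProd s a q₀ n ≠ 0),
        hw.eventually_ne (by simp [hQ0] :
          1 - (eqProd s a q₀ n - 1) / (flowProd s a i q₀ n - 1) ≠ 0)] with q h1 h2 h3 h4 h5 h6
      have E := eqProd_div_sq hs ha ht h1 h2 h3 h4
      have E0 := eqProd_div_sq hs ha ht ((h n).rhombus_ne_zero hs ha ht)
        ((h (n - dir i)).rhombus_ne_zero hs ha ht) ((h n).edgeProd_ne_zero)
        (fun m => (h (n - dir m)).edgeProd_ne_zero m)
      rw [hw0, hQ0] at E0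
      have X (f : Field → ℂ) (hf : f q ≠ 0) (hf0 : f q₀ ≠ 0) :
          Complex.exp (Complex.log (f q / f q₀)) = f q / f q₀ :=
        Complex.exp_log (div_ne_zero hf hf0)
      rw [ht.sum]
      simp only [logFlux, ht.1.symm, ht.2.2.symm, if_true, if_false, Complex.exp_sub,
        Complex.exp_add, two_mul, Complex.exp_log h5, Complex.exp_log h6,
        X _ h1 ((h n).rhombus_ne_zero hs ha ht),
        X _ h2 ((h (n - dir i)).rhombus_ne_zero hs ha ht),
        X _ (h3 _) ((h n).edgeProd_ne_zero _),
        X _ (h4 _) ((h (n - dir _)).edgeProd_ne_zero _)]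
      rw [← sq, E]
      have f1 := (h n).rhombus_ne_zero hs ha ht
      have f2 := (h (n - dir i)).rhombus_ne_zero hs ha ht
      have g1 := (h n).edgeProd_ne_zero i
      have g2 := (h n).edgeProd_ne_zero j
      have g3 := (h n).edgeProd_ne_zero k
      have g4 := (h (n - dir i)).edgeProd_ne_zero i
      have g5 := (h (n - dir j)).edgeProd_ne_zero j
      have g6 := (h (n - dir k)).edgeProd_ne_zero k
      have k1 := h3 i
      have k2 := h3 j
      have k3 := h3 k
      have k4 := h4 i
      have k5 := h4 j
      have k6 := h4 k
      rw [one_pow, div_one] at E0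
      refine (div_one _).symm.trans ?_
      rw [E0]
      field_simp
  filter_upwards [hlog, key, hP.eventually_ne hP1,
    hsl.eventually_ne (by simp [hQ0, logSlope_one] : logSlope (eqProd s a q₀ n) ≠ 0)]
    with q h1 h2 h3 h4
  rw [h1, extVelocity_mul_log h3 h4, h2]

end

/-! ### Summation by parts. -/

section

variable {s : ℂ → ℂ} {a : Fin 3 → ℂ} {q q₀ : Field} {n : ℤ × ℤ} {i j k : Fin 3}

theorem hasDerivAt_lagrangian {φ : ℤ × ℤ → Fin 3 → ℂ × ℂ → ℂ}
    (h : ∀ n k, AnalyticAt ℂ (φ n k) (q₀ n, q₀ (n - dir k))) (n : ℤ × ℤ) :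
    ∀ᶠ q in 𝓝 q₀, ∀ v : Field, HasDerivAt (fun t : ℂ => lagrangian φ n (q + t • v))
      (∑ m, (edgeDeriv (φ n m) n (n - dir m) (1, 0) q * v n +
        edgeDeriv (φ n m) n (n - dir m) (0, 1) q * v (n - dir m))) 0 := by
  have c (m m' : ℤ × ℤ) : ContinuousAt (fun q : Field => (q m, q m')) q₀ := by fun_prop
  have e (k : Fin 3) := (c n (n - dir k)).eventually (h n k).eventually_analyticAt
  filter_upwards [eventually_all.mpr e] with q hq v
  refine HasDerivAt.fun_sum fun m _ => ?_
  have h1 := (hq m).differentiableAt.hasFDerivAt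
  have h2 := (hasDerivAt_line q v n).prodMk (hasDerivAt_line q v (n - dir m))
  have h3 := HasFDerivAt.comp_hasDerivAt (f := fun t : ℂ => ((q + t • v) n, (q + t • v) (n - dir m)))
    0 (by simpa using h1) h2
  convert! h3 using 1
  rw [show (v n, v (n - dir m)) = v n • ((1 : ℂ), (0 : ℂ)) + v (n - dir m) • ((0 : ℂ), (1 : ℂ)) by
    simp, map_add, map_smul, map_smul, smul_eq_mul, smul_eq_mul, edgeDeriv, edgeDeriv]
  ring

/-- The boundary term of the summation by parts on the edge from `n` to `n + dir m`. -/
def boundaryFlux (s : ℂ → ℂ) (a : Fin 3 → ℂ) (i : Fin 3) (φ : ℤ × ℤ → Fin 3 → ℂ × ℂ → ℂ)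
    (m : Fin 3) (n : ℤ × ℤ) (q : Field) : ℂ :=
  edgeDeriv (φ (n + dir m) m) (n + dir m) n (0, 1) q * extVelocity s a i q n

/-- A divergence along the three lattice directions is a divergence along the first two. -/
theorem sum_sub_dir (J : Fin 3 → ℤ × ℤ → ℂ) (n : ℤ × ℤ) :
    ∑ m, (J m n - J m (n - dir m)) =
      (J 0 (n + (1, 0) - dir 0) - J 2 (n + (1, 0) + (0, 1))) - (J 0 (n - dir 0) - J 2 (n + (0, 1))) +
      ((J 1 (n + (0, 1) - dir 1) - J 2 (n + (0, 1))) - (J 1 (n - dir 1) - J 2 n)) := by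
  have e0 : n + (1, 0) - dir 0 = n := add_sub_cancel_right _ _
  have e1 : n + (0, 1) - dir 1 = n := add_sub_cancel_right _ _
  -- The step from $n$ to $n-\mathrm{dir}\,2=n+(1,1)$ is split along the path through $n+(0,1)$.
  have e2 : n + (1, 0) + (0, 1) = n - dir 2 := by rw [sub_dir_two, add_assoc]; rfl
  rw [e0, e1, e2, Fin.sum_univ_three]
  ring

theorem isVariationalSymmetry (hs : IsSigmaLike s) (ha : a 0 + a 1 + a 2 = 0) (i : Fin 3) :
    IsVariationalSymmetry s a i := by
  obtain ⟨j, k, ht⟩ := exists_isTriple i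
  refine ⟨characteristic s a i, fun q n h => ⟨analyticAt_characteristic hs h, ?_⟩,
    fun q₀ φ h hφ => ?_⟩
  · rw [characteristic_window, extVelocity_eq h]
  have hA (n k) := (hφ.1 n k).1
  -- The total flux. `logFlux` accounts for $K\,\delta S/\delta q$; subtracting the boundary flux
  -- moves the second-argument derivatives from $K_{n-\mathrm{dir}\,m}$ to $K_n$.
  set J : Fin 3 → ℤ × ℤ → Field → ℂ := fun m n q =>
    logFlux s a i j k q₀ m n q - boundaryFlux s a i φ m n q with hJ
  have hJl (m n) : IsLocal q₀ 1 n (J m n) :=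
    (isLocal_logFlux hs ha ht (h n) m).sub ((isLocal_edgeDeriv (m' := n) (0, 1)
      (by simpa using hA (n + dir m) m) (near_add_dir n m) (by simp)).mul
      (isLocal_extVelocity hs (h n)))
  -- Radius $2$: each flux has radius $1$ and is taken at a site at distance at most $1$.
  have hAl (n) : IsLocal q₀ 2 n fun q => J 0 (n - dir 0) q - J 2 (n + (0, 1)) q :=
    ((hJl 0 _).shift (near_sub_dir n 0).1 (near_sub_dir n 0).2).sub
      ((hJl 2 _).shift (by simp) (by simp))
  have hBl (n) : IsLocal q₀ 2 n fun q => J 1 (n - dir 1) q - J 2 n q :=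
    ((hJl 1 _).shift (near_sub_dir n 1).1 (near_sub_dir n 1).2).sub
      ((hJl 2 _).shift (by simp) (by simp))
  refine ⟨Finset.Icc (-2, -2) (2, 2),
    fun n u => (fun q => J 0 (n - dir 0) q - J 2 (n + (0, 1)) q) (extend _ q₀ n u),
    fun n u => (fun q => J 1 (n - dir 1) q - J 2 n q) (extend _ q₀ n u),
    fun n => ⟨(hAl n).analyticAt _ n, (hBl n).analyticAt _ n⟩, fun n => ?_⟩
  filter_upwards [hasDerivAt_lagrangian hA n, variationalDerivative_eq hA n,
    extVelocity_mul_variationalDerivative hs ha ht h hφ n] with q h1 h2 h3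
  rw [(hAl n).apply_extend_window, (hAl _).apply_extend_window, (hBl n).apply_extend_window,
    (hBl _).apply_extend_window]
  simp only [characteristic_window]
  convert! h1 (fun m => extVelocity s a i q m) using 1
  rw [← sum_sub_dir fun m n => J m n q]
  simp only [hJ, boundaryFlux, sub_add_cancel]
  rw [h2, Finset.mul_sum] at h3
  simp only [Fin.sum_univ_three] at h3 ⊢
  linear_combination -h3

end

/-! ### The canonical product of the sigma function. -/

section

/-- The factor of the canonical product of the sigma function that belongs to the period `l`. -/
def sigmaFactor (l z : ℂ) : ℂ := (1 - z / l) * Complex.exp (z / l + (z / l) ^ 2 / 2)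

/-- The entire function `σ(z) / z`. -/
def sigmaProd (L : PeriodPair) (z : ℂ) : ℂ := ∏' l : {l : L.lattice // l ≠ 0}, sigmaFactor l z

theorem weierstrassSigma_eq (L : PeriodPair) (z : ℂ) :
    weierstrassSigma L z = z * sigmaProd L z := rfl

theorem hasDerivAt_sigmaFactor_one (w : ℂ) :
    HasDerivAt (sigmaFactor 1) (-w ^ 2 * Complex.exp (w + w ^ 2 / 2)) w := by
  have h1 : HasDerivAt (fun w : ℂ => 1 - w) (-1) w := (hasDerivAt_id' w).const_sub 1
  have h2 : HasDerivAt (fun w : ℂ => w + w ^ 2 / 2) (1 + w) w := by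
    convert! (hasDerivAt_id' w).fun_add ((hasDerivAt_pow 2 w).div_const 2) using 1
    simp
  have e : sigmaFactor 1 = fun w => (1 - w) * Complex.exp (w + w ^ 2 / 2) := by
    funext w; simp [sigmaFactor]
  rw [e]
  convert! h1.fun_mul h2.cexp using 1
  ring

/-- The convergence exponent is chosen so that the derivative of the factor is $-w^2e^{w+w^2/2}$.
The deviation from $1$ is therefore cubic, and $\sum|l|^{-3}<\infty$ makes the product converge. -/
theorem norm_sigmaFactor_one_sub_one_le {w : ℂ} (hw : ‖w‖ ≤ 1) :
    ‖sigmaFactor 1 w - 1‖ ≤ Real.exp 2 * ‖w‖ ^ 3 := by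
  have h := Convex.norm_image_sub_le_of_norm_hasDerivWithin_le (𝕜 := ℂ) (f := sigmaFactor 1)
    (s := Metric.closedBall (0 : ℂ) ‖w‖) (C := ‖w‖ ^ 2 * Real.exp 2) (x := 0) (y := w)
    (fun x _ => (hasDerivAt_sigmaFactor_one x).hasDerivWithinAt) ?_ (convex_closedBall _ _)
    (by simp) (by simp)
  · have h0 : sigmaFactor 1 0 = 1 := by simp [sigmaFactor]
    rw [h0, sub_zero] at h
    calc _ ≤ _ := h
      _ = _ := by ring
  · intro x hx
    have hx' : ‖x‖ ≤ ‖w‖ := by simpa using hx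
    have hx1 := hx'.trans hw
    rw [norm_mul, norm_neg, norm_pow]
    gcongr
    refine (Complex.norm_exp_le_exp_norm _).trans (Real.exp_le_exp.mpr ?_)
    refine (norm_add_le _ _).trans ?_
    rw [norm_div, norm_pow]
    have : ‖x‖ ^ 2 ≤ 1 := pow_le_one₀ (norm_nonneg _) hx1
    simp only [Complex.norm_ofNat]
    linarith

theorem sigmaFactor_eq (l z : ℂ) : sigmaFactor l z = sigmaFactor 1 (z / l) := by
  simp [sigmaFactor]

theorem differentiable_sigmaFactor (l : ℂ) : Differentiable ℂ (sigmaFactor l) := by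
  unfold sigmaFactor; fun_prop

variable (L : PeriodPair)

theorem summable_norm_inv_cube :
    Summable fun l : {l : L.lattice // l ≠ 0} => ‖(l : ℂ)‖⁻¹ ^ 3 :=
  (ZLattice.summable_norm_pow_inv L.lattice 3 (by simp)).subtype _

theorem ne_zero_of_subtype (l : {l : L.lattice // l ≠ 0}) : (l : ℂ) ≠ 0 := by
  simpa using l.2

theorem eventually_norm_sigmaFactor_sub_one_le (R : ℝ) (hR : 0 < R) :
    ∀ᶠ l : {l : L.lattice // l ≠ 0} in cofinite, ∀ z ∈ Metric.ball (0 : ℂ) R,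
      ‖sigmaFactor l z - 1‖ ≤ Real.exp 2 * R ^ 3 * ‖(l : ℂ)‖⁻¹ ^ 3 := by
  have h := (summable_norm_inv_cube L).tendsto_cofinite_zero.eventually_lt_const
    (show (0 : ℝ) < R⁻¹ ^ 3 by positivity)
  filter_upwards [h] with l hl z hz
  have hl0 : 0 < ‖(l : ℂ)‖ := norm_pos_iff.mpr (ne_zero_of_subtype L l)
  have hl1 : R < ‖(l : ℂ)‖ := by
    have := lt_of_pow_lt_pow_left₀ 3 (by positivity) hl
    exact (inv_lt_inv₀ hl0 hR).mp this
  have hz' : ‖z‖ ≤ R := by simpa using (mem_ball_zero_iff.mp hz).le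
  have hw : ‖z / l‖ ≤ R * ‖(l : ℂ)‖⁻¹ := by
    rw [norm_div, div_eq_mul_inv]; gcongr
  have hw1 : ‖z / l‖ ≤ 1 := by
    rw [norm_div]; exact (div_le_one hl0).mpr (hz'.trans hl1.le)
  rw [sigmaFactor_eq]
  refine (norm_sigmaFactor_one_sub_one_le hw1).trans ?_
  calc Real.exp 2 * ‖z / l‖ ^ 3 ≤ Real.exp 2 * (R * ‖(l : ℂ)‖⁻¹) ^ 3 := by gcongr
    _ = _ := by ring

theorem hasProdLocallyUniformlyOn_sigmaFactor (R : ℝ) (hR : 0 < R) :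
    HasProdLocallyUniformlyOn (fun (l : {l : L.lattice // l ≠ 0}) z => sigmaFactor l z)
      (sigmaProd L) (Metric.ball (0 : ℂ) R) := by
  have := Summable.hasProdLocallyUniformlyOn_one_add (f := fun (l : {l : L.lattice // l ≠ 0}) z =>
    sigmaFactor l z - 1) Metric.isOpen_ball ((summable_norm_inv_cube L).mul_left (Real.exp 2 * R ^ 3))
    (eventually_norm_sigmaFactor_sub_one_le L R hR)
    (fun l => ((differentiable_sigmaFactor l).continuous.sub continuous_const).continuousOn)
  simp only [add_sub_cancel] at this
  exact this

theorem mem_ball_norm_add_one (z : ℂ) : z ∈ Metric.ball (0 : ℂ) (‖z‖ + 1) := by simp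

theorem differentiable_sigmaProd : Differentiable ℂ (sigmaProd L) := by
  intro z
  have h : DifferentiableOn ℂ (sigmaProd L) (Metric.ball (0 : ℂ) (‖z‖ + 1)) :=
    (hasProdLocallyUniformlyOn_sigmaFactor L (‖z‖ + 1) (by positivity)).differentiableOn
      (.of_forall fun t => by
        simpa [Finset.prod_fn] using DifferentiableOn.finsetProd (u := t)
          (f := fun (l : {l : L.lattice // l ≠ 0}) z => sigmaFactor l z)
          (fun l _ => (differentiable_sigmaFactor l).differentiableOn)) Metric.isOpen_ball
  exact h.differentiableAt (Metric.isOpen_ball.mem_nhds (mem_ball_norm_add_one z))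

theorem summable_norm_sigmaFactor_sub_one (z : ℂ) :
    Summable fun l : {l : L.lattice // l ≠ 0} => ‖sigmaFactor l z - 1‖ := by
  refine ((summable_norm_inv_cube L).mul_left
    (Real.exp 2 * (‖z‖ + 1) ^ 3)).of_norm_bounded_eventually ?_
  filter_upwards [eventually_norm_sigmaFactor_sub_one_le L (‖z‖ + 1) (by positivity)] with l hl
  rw [norm_norm]
  exact hl z (mem_ball_norm_add_one z)

theorem sigmaProd_ne_zero {z : ℂ} (hz : z ∈ L.lattice → z = 0) : sigmaProd L z ≠ 0 := by
  have h := tprod_one_add_ne_zero_of_summable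
    (f := fun l : {l : L.lattice // l ≠ 0} => sigmaFactor l z - 1) ?_
    (summable_norm_sigmaFactor_sub_one L z)
  · simpa only [add_sub_cancel, sigmaProd] using h
  · intro l
    rw [add_sub_cancel]
    refine mul_ne_zero (fun h => ?_) (Complex.exp_ne_zero _)
    have hl := ne_zero_of_subtype L l
    have : z = l := by
      field_simp at h
      linear_combination -h
    exact hl (this ▸ hz (this ▸ l.1.2))

theorem sigmaProd_zero : sigmaProd L 0 = 1 := by
  simp [sigmaProd, sigmaFactor]

theorem sigmaProd_neg (z : ℂ) : sigmaProd L (-z) = sigmaProd L z := by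
  rw [sigmaProd, sigmaProd,
    ← ((Equiv.neg L.lattice).subtypeEquiv (p := fun l => l ≠ 0) (q := fun l => l ≠ 0)
      (by simp)).tprod_eq]
  refine tprod_congr fun l => ?_
  simp [sigmaFactor, Equiv.subtypeEquiv]

theorem sigmaProd_coe (l : {l : L.lattice // l ≠ 0}) : sigmaProd L l = 0 := by
  refine tprod_of_exists_eq_zero ⟨l, ?_⟩
  simp [sigmaFactor, div_self (ne_zero_of_subtype L l)]

theorem differentiable_weierstrassSigma : Differentiable ℂ (weierstrassSigma L) :=
  differentiable_id.mul (differentiable_sigmaProd L)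

theorem weierstrassSigma_neg (z : ℂ) : weierstrassSigma L (-z) = -weierstrassSigma L z := by
  rw [weierstrassSigma_eq, weierstrassSigma_eq, sigmaProd_neg, neg_mul]

theorem weierstrassSigma_eq_zero_iff {z : ℂ} : weierstrassSigma L z = 0 ↔ z ∈ L.lattice := by
  rw [weierstrassSigma_eq, mul_eq_zero]
  constructor
  · rintro (rfl | h)
    · exact zero_mem _
    · by_contra hz
      exact sigmaProd_ne_zero L (fun h => absurd h hz) h
  · intro hz
    by_cases h0 : z = 0
    · exact Or.inl h0
    · exact Or.inr (sigmaProd_coe L ⟨⟨z, hz⟩, by simpa using h0⟩)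

theorem deriv_weierstrassSigma_zero : deriv (weierstrassSigma L) 0 = 1 := by
  have h := (hasDerivAt_id' (0 : ℂ)).fun_mul (differentiable_sigmaProd L 0).hasDerivAt
  rw [one_mul, zero_mul, add_zero, sigmaProd_zero] at h
  exact h.deriv

theorem logDeriv_sigmaFactor {l z : ℂ} (hl : l ≠ 0) (hz : z ≠ l) :
    logDeriv (sigmaFactor l) z = z ^ 2 / (l ^ 2 * (z - l)) := by
  have h1 : HasDerivAt (sigmaFactor l) (-(z / l) ^ 2 * Complex.exp (z / l + (z / l) ^ 2 / 2) *
      (1 / l)) z := by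
    rw [show sigmaFactor l = fun z => sigmaFactor 1 (z / l) from funext (sigmaFactor_eq l)]
    exact (hasDerivAt_sigmaFactor_one (z / l)).comp z ((hasDerivAt_id' z).div_const l)
  have h2 : z - l ≠ 0 := sub_ne_zero.mpr hz
  have h3 : 1 - z / l ≠ 0 := by
    rw [one_sub_div hl]
    exact div_ne_zero (sub_ne_zero.mpr hz.symm) hl
  have h4 := Complex.exp_ne_zero (z / l + (z / l) ^ 2 / 2)
  rw [logDeriv_apply, h1.deriv, sigmaFactor]
  generalize Complex.exp (z / l + (z / l) ^ 2 / 2) = e at h4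
  have h5 : l - z ≠ 0 := sub_ne_zero.mpr hz.symm
  rw [one_sub_div hl]
  field_simp
  ring

/-- Near a point off the lattice $|w-l|$ is bounded below, hence $|l|\le C|w-l|$, and the terms of
the series for $\sigma'/\sigma$ are $O(|l|^{-3})$ uniformly. -/
theorem exists_summable_bound {z : ℂ} (hz : z ∉ L.lattice) :
    ∃ U : Set ℂ, IsOpen U ∧ z ∈ U ∧ (∀ w ∈ U, w ∉ L.lattice) ∧
      ∃ u : {l : L.lattice // l ≠ 0} → ℝ, Summable u ∧
        ∀ (l : {l : L.lattice // l ≠ 0}), ∀ w ∈ U, ‖w ^ 2 / ((l : ℂ) ^ 2 * (w - l))‖ ≤ u l := by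
  obtain ⟨δ, hδ, hb⟩ := Metric.isOpen_iff.mp L.isClosed_lattice.isOpen_compl z hz
  set R := ‖z‖ + δ with hR
  have hR0 : 0 < R := by positivity
  refine ⟨Metric.ball z (δ / 2), Metric.isOpen_ball, Metric.mem_ball_self (by positivity),
    fun w hw => hb (Metric.ball_subset_ball (by linarith) hw),
    fun l => R ^ 2 * (1 + R / (δ / 2)) * ‖(l : ℂ)‖⁻¹ ^ 3, (summable_norm_inv_cube L).mul_left _,
    fun l w hw => ?_⟩
  have hw' : dist w z < δ / 2 := hw
  have hwR : ‖w‖ ≤ R := by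
    have := norm_le_norm_add_norm_sub' w z
    rw [← dist_eq_norm] at this
    linarith
  have hd : δ / 2 ≤ ‖w - l‖ := by
    by_contra! h
    refine hb (a := (l : ℂ)) ?_ l.1.2
    rw [Metric.mem_ball]
    calc dist (l : ℂ) z ≤ dist (l : ℂ) w + dist w z := dist_triangle _ _ _
      _ < δ / 2 + δ / 2 := add_lt_add (by rwa [dist_comm, dist_eq_norm]) hw'
      _ = δ := by ring
  have hl0 : 0 < ‖(l : ℂ)‖ := norm_pos_iff.mpr (ne_zero_of_subtype L l)
  have hl : ‖(l : ℂ)‖ ≤ (1 + R / (δ / 2)) * ‖w - l‖ := by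
    have h1 : ‖(l : ℂ)‖ ≤ ‖w‖ + ‖w - l‖ := by
      have := norm_sub_le w (w - l)
      rwa [sub_sub_cancel] at this
    have h2 : R ≤ R / (δ / 2) * ‖w - l‖ := by
      rw [div_mul_eq_mul_div, le_div_iff₀ (by positivity)]
      gcongr
    linarith
  have hwl : 0 < ‖w - l‖ := lt_of_lt_of_le (by positivity) hd
  rw [norm_div, norm_mul, norm_pow, norm_pow, div_le_iff₀ (by positivity)]
  have e : R ^ 2 * (1 + R / (δ / 2)) * ‖(l : ℂ)‖⁻¹ ^ 3 * (‖(l : ℂ)‖ ^ 2 * ‖w - l‖) =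
      R ^ 2 * (((1 + R / (δ / 2)) * ‖w - l‖) * ‖(l : ℂ)‖⁻¹) := by
    field_simp
  rw [e]
  calc ‖w‖ ^ 2 ≤ R ^ 2 * 1 := by rw [mul_one]; gcongr
    _ ≤ _ := by
      gcongr
      rw [← div_eq_mul_inv, one_le_div hl0]
      exact hl

end

/-! ### Quasi-periodicity, the three-term identity, and the admissible functions. -/

section

variable (L : PeriodPair)

theorem isPreconnected_compl_lattice : IsPreconnected (L.lattice : Set ℂ)ᶜ := by
  refine (Set.Countable.isConnected_compl_of_one_lt_rank (by simp) ?_).2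
  exact countable_of_Lindelof_of_discrete (X := L.lattice)

theorem weierstrassSigma_ne_zero {z : ℂ} (hz : z ∉ L.lattice) : weierstrassSigma L z ≠ 0 :=
  fun h => hz ((weierstrassSigma_eq_zero_iff L).mp h)

theorem logDeriv_weierstrassSigma {z : ℂ} (hz : z ∉ L.lattice) :
    logDeriv (weierstrassSigma L) z =
      1 / z + ∑' l : {l : L.lattice // l ≠ 0}, z ^ 2 / ((l : ℂ) ^ 2 * (z - l)) := by
  have hz0 : z ≠ 0 := fun h => hz (h ▸ zero_mem _)
  have hne (l : {l : L.lattice // l ≠ 0}) : z ≠ l := fun h => hz (h ▸ l.1.2)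
  have hprod : sigmaProd L z ≠ 0 := sigmaProd_ne_zero L fun h => absurd h hz
  have hl (l : {l : L.lattice // l ≠ 0}) := logDeriv_sigmaFactor (ne_zero_of_subtype L l) (hne l)
  obtain ⟨U, hU, hzU, hU', u, hu, hb⟩ := exists_summable_bound L hz
  have h1 : logDeriv (sigmaProd L) z = ∑' l : {l : L.lattice // l ≠ 0},
      logDeriv (sigmaFactor l) z := by
    refine logDeriv_tprod_eq_tsum Metric.isOpen_ball (mem_ball_norm_add_one z)
      (f := fun (l : {l : L.lattice // l ≠ 0}) => sigmaFactor l) (fun l => ?_)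
      (fun l => (differentiable_sigmaFactor l).differentiableOn) ?_
      (hasProdLocallyUniformlyOn_sigmaFactor L (‖z‖ + 1)
        (by positivity)).multipliableLocallyUniformlyOn hprod
    · refine mul_ne_zero ?_ (Complex.exp_ne_zero _)
      rw [one_sub_div (ne_zero_of_subtype L l)]
      exact div_ne_zero (sub_ne_zero.mpr (hne l).symm) (ne_zero_of_subtype L l)
    · simp only [hl]
      exact Summable.of_norm_bounded hu fun l => hb l z hzU
  have h2 : logDeriv (weierstrassSigma L) z = logDeriv (fun z => z) z + logDeriv (sigmaProd L) z :=
    logDeriv_mul z hz0 hprod differentiableAt_id (differentiable_sigmaProd L z)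
  rw [h2, h1]
  simp only [hl]
  congr 1
  simp [logDeriv_apply]

theorem hasSum_weierstrassP_ne_zero (z : ℂ) :
    HasSum (fun l : {l : L.lattice // l ≠ 0} => 1 / (z - l) ^ 2 - 1 / (l : ℂ) ^ 2)
      (L.weierstrassP z - 1 / z ^ 2) := by
  have h := L.hasSum_weierstrassP z
  -- The sum for $\wp$ runs over all lattice points. At $l=0$ its term is $1/z^2$, because $1/0=0$.
  rw [show L.weierstrassP z = (L.weierstrassP z - 1 / z ^ 2) +
    ∑ l ∈ ({0} : Finset L.lattice), (1 / (z - l) ^ 2 - 1 / (l : ℂ) ^ 2) by simp] at h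
  have h1 := (Finset.hasSum_compl_iff _).mpr h
  refine ((Equiv.subtypeEquivRight (p := fun l : L.lattice => l ≠ 0)
    (q := fun l => l ∉ ({0} : Finset L.lattice)) (by simp)).hasSum_iff).mpr h1

/-- Termwise differentiation of the series for $\sigma'/\sigma$ gives the series for $-\wp$. -/
theorem hasDerivAt_logDeriv_weierstrassSigma {z : ℂ} (hz : z ∉ L.lattice) :
    HasDerivAt (logDeriv (weierstrassSigma L)) (-L.weierstrassP z) z := by
  obtain ⟨U, hU, hzU, hU', u, hu, hb⟩ := exists_summable_bound L hz
  have hz0 : z ≠ 0 := fun h => hz (h ▸ zero_mem _)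
  have hd {w : ℂ} (hw : w ∉ L.lattice) (l : {l : L.lattice // l ≠ 0}) :
      HasDerivAt (fun w => w ^ 2 / ((l : ℂ) ^ 2 * (w - l)))
        (-(1 / (w - l) ^ 2 - 1 / (l : ℂ) ^ 2)) w := by
    have hl := ne_zero_of_subtype L l
    have hwl : w - l ≠ 0 := sub_ne_zero.mpr fun h => hw (h ▸ l.1.2)
    convert! (hasDerivAt_pow 2 w).fun_div (((hasDerivAt_id' w).sub_const (l : ℂ)).const_mul
      ((l : ℂ) ^ 2)) (mul_ne_zero (pow_ne_zero 2 hl) hwl) using 1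
    field_simp
    ring
  have hdU (l : {l : L.lattice // l ≠ 0}) :
      DifferentiableOn ℂ (fun w => w ^ 2 / ((l : ℂ) ^ 2 * (w - l))) U :=
    fun w hw => (hd (hU' w hw) l).differentiableAt.differentiableWithinAt
  have h1 := Complex.hasSum_deriv_of_summable_norm hu hdU hU hb hzU
  have h2 := (Complex.differentiableOn_tsum_of_summable_norm hu hdU hU hb).differentiableAt
    (hU.mem_nhds hzU)
  have h3 : deriv (fun w => ∑' l : {l : L.lattice // l ≠ 0}, w ^ 2 / ((l : ℂ) ^ 2 * (w - l))) z =
      -(L.weierstrassP z - 1 / z ^ 2) := by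
    refine h1.unique ?_
    simp only [(hd hz _).deriv]
    exact (hasSum_weierstrassP_ne_zero L z).neg
  have h4 := (hasDerivAt_inv hz0).fun_add (h3 ▸ h2.hasDerivAt)
  have h5 := h4.congr_of_eventuallyEq (f₁ := logDeriv (weierstrassSigma L)) ?_
  · convert! h5 using 1
    field_simp
    ring
  · filter_upwards [hU.mem_nhds hzU] with w hw
    rw [logDeriv_weierstrassSigma L (hU' w hw), one_div]

theorem add_notMem_lattice {z ω : ℂ} (hz : z ∉ L.lattice) (hω : ω ∈ L.lattice) :
    z + ω ∉ L.lattice :=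
  fun h => hz (by simpa using sub_mem h hω)

/-- Periodicity of $\wp$ makes $\zeta(z+\omega)-\zeta(z)$, with $\zeta=\sigma'/\sigma$, a constant
$\eta$ on the connected complement of the lattice. Then $\sigma(z+\omega)e^{-\eta z}/\sigma(z)$ has
zero derivative there. -/
theorem exists_weierstrassSigma_add {ω : ℂ} (hω : ω ∈ L.lattice) :
    ∃ η C : ℂ, ∀ z, weierstrassSigma L (z + ω) = C * Complex.exp (η * z) * weierstrassSigma L z := by
  have hU := L.isClosed_lattice.isOpen_compl
  have hd {z : ℂ} (hz : z ∉ L.lattice) :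
      HasDerivAt (fun z => logDeriv (weierstrassSigma L) (z + ω) - logDeriv (weierstrassSigma L) z)
        0 z := by
    have h := ((hasDerivAt_logDeriv_weierstrassSigma L (add_notMem_lattice L hz hω)).comp_add_const
      z ω).fun_sub (hasDerivAt_logDeriv_weierstrassSigma L hz)
    rwa [L.weierstrassP_add_coe z ⟨ω, hω⟩, sub_self] at h
  obtain ⟨η, hη⟩ := hU.exists_is_const_of_deriv_eq_zero (isPreconnected_compl_lattice L)
    (fun z hz => (hd hz).differentiableAt.differentiableWithinAt) (fun z hz => (hd hz).deriv)
  have hd' {z : ℂ} (hz : z ∉ L.lattice) :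
      HasDerivAt (fun z => weierstrassSigma L (z + ω) * Complex.exp (-(η * z)) /
        weierstrassSigma L z) 0 z := by
    have n1 := weierstrassSigma_ne_zero L hz
    have n2 := weierstrassSigma_ne_zero L (add_notMem_lattice L hz hω)
    have h1 := hη z hz
    have e : HasDerivAt (fun z => Complex.exp (-(η * z))) (Complex.exp (-(η * z)) * (-(η * 1))) z :=
      ((hasDerivAt_id' z).const_mul η).fun_neg.cexp
    have h := ((((differentiable_weierstrassSigma L) (z + ω)).hasDerivAt.comp_add_const z ω).fun_mul
      e).fun_div ((differentiable_weierstrassSigma L) z).hasDerivAt n1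
    convert! h using 1
    rw [logDeriv_apply, logDeriv_apply] at h1
    generalize Complex.exp (-(η * z)) = E
    field_simp at h1 ⊢
    linear_combination (-E) * h1
  obtain ⟨C, hC⟩ := hU.exists_is_const_of_deriv_eq_zero (isPreconnected_compl_lattice L)
    (fun z hz => (hd' hz).differentiableAt.differentiableWithinAt) (fun z hz => (hd' hz).deriv)
  refine ⟨η, C, fun z => ?_⟩
  by_cases hz : z ∈ L.lattice
  · rw [(weierstrassSigma_eq_zero_iff L).mpr hz,
      (weierstrassSigma_eq_zero_iff L).mpr (add_mem hz hω), mul_zero]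
  · rw [← hC z hz, div_mul_eq_mul_div, div_mul_cancel₀ _ (weierstrassSigma_ne_zero L hz), mul_assoc,
      ← Complex.exp_add, neg_add_cancel, Complex.exp_zero, mul_one]

/-- Evenness kills the first derivative at the origin, so the zero is at least double. -/
theorem exists_eq_sq_mul {Φ : ℂ → ℂ} (hΦ : Differentiable ℂ Φ) (heven : ∀ z, Φ (-z) = Φ z)
    (h0 : Φ 0 = 0) : ∃ Ψ : ℂ → ℂ, Differentiable ℂ Ψ ∧ ∀ z, Φ z = z ^ 2 * Ψ z := by
  have hD {f : ℂ → ℂ} (hf : Differentiable ℂ f) : Differentiable ℂ (dslope f 0) := by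
    rw [← differentiableOn_univ] at hf ⊢
    exact (Complex.differentiableOn_dslope Filter.univ_mem).mpr hf
  have hd : deriv Φ 0 = 0 := by
    have h1 := deriv_comp_neg (f := Φ) 0
    simp only [heven, neg_zero] at h1
    linear_combination h1 / 2
  refine ⟨dslope (dslope Φ 0) 0, hD (hD hΦ), fun z => ?_⟩
  have h1 := sub_smul_dslope Φ 0 z
  have h2 := sub_smul_dslope (dslope Φ 0) 0 z
  rw [dslope_same, hd, sub_zero, sub_zero, smul_eq_mul] at h2
  rw [h0, sub_zero, sub_zero, smul_eq_mul] at h1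
  rw [← h1, ← h2]
  ring

/-- An even entire function that vanishes at the origin and has the multipliers of `σ ^ 2` is a
multiple of `σ ^ 2`. -/
theorem eq_const_mul_sigma_sq {Φ : ℂ → ℂ} (hΦ : Differentiable ℂ Φ) (heven : ∀ z, Φ (-z) = Φ z)
    (h0 : Φ 0 = 0) (hper : ∀ z, ∀ ω ∈ L.lattice, Φ (z + ω) * weierstrassSigma L z ^ 2 =
      Φ z * weierstrassSigma L (z + ω) ^ 2) : ∃ κ, ∀ z, Φ z = κ * weierstrassSigma L z ^ 2 := by
  classical
  obtain ⟨Ψ, hΨ, hΨ'⟩ := exists_eq_sq_mul hΦ heven h0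
  have hS := differentiable_weierstrassSigma L
  -- The quotient $\Phi/\sigma^2$ with its removable singularities filled in: at the origin the
  -- limit is $\Psi(0)$ since $\sigma(z)/z\to1$, and periodicity carries this to every lattice
  -- point. An entire periodic function is bounded, hence constant.
  set R : ℂ → ℂ := fun z => if z ∈ L.lattice then Ψ 0 else Φ z / weierstrassSigma L z ^ 2 with hR
  have hRper (z ω : ℂ) (hω : ω ∈ L.lattice) : R (z + ω) = R z := by
    have hmem : z + ω ∈ L.lattice ↔ z ∈ L.lattice := Submodule.add_mem_iff_left _ hω
    by_cases hz : z ∈ L.lattice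
    · simp only [hR, hmem, hz, if_true]
    · simp only [hR, hmem, hz, if_false]
      rw [div_eq_div_iff (pow_ne_zero 2 (weierstrassSigma_ne_zero L (add_notMem_lattice L hz hω)))
        (pow_ne_zero 2 (weierstrassSigma_ne_zero L hz)), hper z ω hω]
  have hR0 : DifferentiableAt ℂ R 0 := by
    have h1 : DifferentiableAt ℂ (fun z => Ψ z / sigmaProd L z ^ 2) 0 :=
      (hΨ 0).fun_div ((differentiable_sigmaProd L 0).fun_pow 2) (by simp [sigmaProd_zero])
    refine h1.congr_of_eventuallyEq ?_
    filter_upwards [L.compl_lattice_sdiff_singleton_mem_nhds 0] with z hz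
    by_cases hz0 : z = 0
    · simp [hR, hz0, sigmaProd_zero]
    · have hzL : z ∉ L.lattice := fun h => hz ⟨h, hz0⟩
      simp only [hR, hzL, if_false, hΨ', weierstrassSigma_eq, mul_pow]
      rw [mul_div_mul_left _ _ (pow_ne_zero 2 hz0)]
  have hRd : Differentiable ℂ R := by
    intro z
    by_cases hz : z ∈ L.lattice
    · have e : R = fun w => R (w - z) := by
        funext w
        have := hRper (w - z) z hz
        rwa [sub_add_cancel] at this
      rw [e]
      exact DifferentiableAt.comp z (f := fun w => w - z) (by simpa using hR0) (by fun_prop)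
    · refine ((hΦ z).fun_div ((hS z).fun_pow 2)
        (pow_ne_zero 2 (weierstrassSigma_ne_zero L hz))).congr_of_eventuallyEq ?_
      filter_upwards [L.isClosed_lattice.isOpen_compl.mem_nhds hz] with w hw
      have hw' : w ∉ L.lattice := hw
      simp only [hR, hw', if_false]
  have hb := (IsZLattice.isCompact_range_of_periodic L.lattice R hRd.continuous hRper).isBounded
  have hden : Dense (L.lattice : Set ℂ)ᶜ :=
    (countable_of_Lindelof_of_discrete (X := L.lattice)).to_set.dense_compl ℝ
  refine ⟨R 0, congrFun (hΦ.continuous.ext_on hden (continuous_const.mul (hS.continuous.pow 2))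
    fun z hz => ?_)⟩
  have hz' : z ∉ L.lattice := hz
  rw [← hRd.apply_eq_apply_of_bounded hb z 0]
  simp only [hR, hz', if_false]
  rw [div_mul_cancel₀ _ (pow_ne_zero 2 (weierstrassSigma_ne_zero L hz'))]

/-- As a function of $u$ the left-hand side is even, vanishes at $0$ and has the multipliers of
$\sigma^2$, so it is $\kappa\,\sigma(u)^2$. Setting $u=w$ determines $\kappa$. -/
theorem weierstrassSigma_three_term (u v : ℂ) {w : ℂ} (hw : w ∉ L.lattice) :
    weierstrassSigma L (u + v) * weierstrassSigma L (u - v) * weierstrassSigma L w ^ 2 -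
      weierstrassSigma L (u + w) * weierstrassSigma L (u - w) * weierstrassSigma L v ^ 2 =
    weierstrassSigma L (w + v) * weierstrassSigma L (w - v) * weierstrassSigma L u ^ 2 := by
  have hS := differentiable_weierstrassSigma L
  have hodd := weierstrassSigma_neg L
  have hzero : weierstrassSigma L 0 = 0 := (weierstrassSigma_eq_zero_iff L).mpr (zero_mem _)
  have hprod (u v : ℂ) : weierstrassSigma L (-u + v) * weierstrassSigma L (-u - v) =
      weierstrassSigma L (u + v) * weierstrassSigma L (u - v) := by
    rw [show -u + v = -(u - v) by ring, show -u - v = -(u + v) by ring, hodd, hodd]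
    ring
  obtain ⟨κ, hκ⟩ := eq_const_mul_sigma_sq L (Φ := fun u =>
    weierstrassSigma L (u + v) * weierstrassSigma L (u - v) * weierstrassSigma L w ^ 2 -
      weierstrassSigma L (u + w) * weierstrassSigma L (u - w) * weierstrassSigma L v ^ 2)
    (by fun_prop) (fun u => by simp only [hprod]) (by simp only [zero_add, zero_sub, hodd]; ring)
    (fun u ω hω => by
      obtain ⟨η, C, h⟩ := exists_weierstrassSigma_add L hω
      have e (x : ℂ) : weierstrassSigma L (u + ω + x) * weierstrassSigma L (u + ω - x) =
          (C * Complex.exp (η * u)) ^ 2 *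
            (weierstrassSigma L (u + x) * weierstrassSigma L (u - x)) := by
        rw [show u + ω + x = u + x + ω by ring, show u + ω - x = u - x + ω by ring, h, h,
          mul_add, mul_sub, Complex.exp_add, Complex.exp_sub]
        have := Complex.exp_ne_zero (η * x)
        field_simp
      simp only [e, h]
      ring)
  have hκw := hκ w
  have hw0 := weierstrassSigma_ne_zero L hw
  simp only [sub_self, hzero, mul_zero, zero_mul, sub_zero] at hκw
  rw [mul_right_cancel₀ (pow_ne_zero 2 hw0) hκw]
  exact hκ u

theorem isSigmaLike_weierstrassSigma : IsSigmaLike (weierstrassSigma L) := by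
  refine ⟨differentiable_weierstrassSigma L, weierstrassSigma_neg L, ?_,
    by simp [deriv_weierstrassSigma_zero]⟩
  -- Any point off the lattice would serve; dividing the three-term identity by $\sigma(w)^2$
  -- exhibits the rank-two form.
  set w := L.ω₁ / 2
  have hw : w ∉ L.lattice := L.ω₁_div_two_notMem_lattice
  refine ⟨fun u => weierstrassSigma L u ^ 2, fun v => weierstrassSigma L (w + v) *
    weierstrassSigma L (w - v) / weierstrassSigma L w ^ 2, fun x p => ?_⟩
  have h := weierstrassSigma_three_term L x p hw
  have hw0 := weierstrassSigma_ne_zero L hw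
  have hx : weierstrassSigma L (w - x) = -weierstrassSigma L (x - w) := by
    rw [← weierstrassSigma_neg, neg_sub]
  dsimp only
  rw [hx, add_comm w x]
  field_simp
  linear_combination h

theorem isSigmaLike_sinh : IsSigmaLike Complex.sinh := by
  refine ⟨Complex.differentiable_sinh, Complex.sinh_neg,
    ⟨fun x => Complex.sinh x ^ 2, fun _ => 1, fun x p => ?_⟩, by simp⟩
  rw [Complex.sinh_add, Complex.sinh_sub]
  linear_combination Complex.sinh x ^ 2 * Complex.cosh_sq p -
    Complex.sinh p ^ 2 * Complex.cosh_sq x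

theorem isSigmaLike_id : IsSigmaLike fun x => x :=
  ⟨differentiable_id, fun _ => rfl, ⟨fun x => x ^ 2, fun _ => 1, fun x p => by ring⟩, by simp⟩

theorem IsAdmissible.isSigmaLike {s : ℂ → ℂ} (hs : IsAdmissible s) : IsSigmaLike s := by
  rcases hs with ⟨L, rfl⟩ | rfl | rfl
  · exact isSigmaLike_weierstrassSigma L
  · exact isSigmaLike_sinh
  · exact isSigmaLike_id

end

end TriLattice

end

theorem mainTheorem2 (s : ℂ → ℂ) (hs : TriLattice.IsAdmissible s) (α β γ : ℂ)
    (hsum : α + β + γ = 0) :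
    (∀ j : Fin 3, TriLattice.IsConsistent s ![α, β, γ] j) ∧
    (∀ i j : Fin 3, TriLattice.FlowsCommute s ![α, β, γ] i j) ∧
    (∀ q₀ : TriLattice.Field, (∀ n, TriLattice.IsSolutionAt s ![α, β, γ] q₀ n) →
      ∃ φ, TriLattice.IsActionBranch s ![α, β, γ] q₀ φ) ∧
    (∀ j : Fin 3, TriLattice.IsVariationalSymmetry s ![α, β, γ] j) :=
  have h := hs.isSigmaLike
  have ha : ![α, β, γ] 0 + ![α, β, γ] 1 + ![α, β, γ] 2 = 0 := hsum
  ⟨TriLattice.isConsistent h ha, TriLattice.flowsCommute h ha,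
    TriLattice.exists_isActionBranch h, TriLattice.isVariationalSymmetry h ha⟩
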